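/- Let $k$ be a field of characteristic $p>0$ with $[k:k^p]<\infty$, let $S=k[x_0,\dots,x_n]$ ($n\ge 0$) with its standard grading, and let $\mathfrak m=(x_0,\dots,x_n)$. Let $f_1,\dots,f_c\in S$ be homogeneous polynomials forming a regular sequence, and set $J=(f_1,\dots,f_c)$, $R=S/J$ and $d=\sum_{j=1}^c\deg f_j$. For an ideal $I$ of $S$ write $I^{[p]}=(a^p \mid a\in I)$. Then there is a smallest ideal $\tau$ of $S$ such that $J\subseteq\tau$ and $(f_1\cdots f_c)^{p-1}\in\tau^{[p]}$. Assume moreover that $\tau\neq S$. Then $\sqrt{\tau}=\mathfrak m$ if and only if the Frobenius action on local cohomology $$F\colon H^{n+1-c}_{\mathfrak m}(R)_{<-(n+1-c)d}\longrightarrow H^{n+1-c}_{\mathfrak m}(R)_{<-p(n+1-c)d}$$ is injective. Here $H^{n+1-c}_{\mathfrak m}(R)_{<N}$ denotes the sum of the homogeneous components of degree less than $N$ of the $\mathbb Z$-graded module $H^{n+1-c}_{\mathfrak m}(R)$, and $F$ is induced by the Frobenius endomorphism $a\mapsto a^p$ on the Čech complex of $R$ with respect to $x_0,\dots,x_n$.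 -/

import Mathlib

open MvPolynomial

/-! ## The Frobenius endomorphism of a ring in which `p = 0` (possibly the zero ring) -/

theorem add_pow_of_prime_eq_zero (p : ℕ) [Fact p.Prime] {A : Type*} [CommRing A]
    (hp : (p : A) = 0) (a b : A) : (a + b) ^ p = a ^ p + b ^ p := by
  rcases subsingleton_or_nontrivial A with h | h
  · exact Subsingleton.elim _ _
  · have : CharP A p := (CharP.charP_iff_prime_eq_zero Fact.out).2 hp
    exact add_pow_char a b p

/-- The Frobenius endomorphism `a ↦ a ^ p` of a commutative ring in which `p = 0`.
Mathlib's `frobenius` excludes the zero ring, which may occur as a localization. -/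
def frob (p : ℕ) [Fact p.Prime] (A : Type*) [CommRing A] (hp : (p : A) = 0) : A →+* A where
  toFun a := a ^ p
  map_one' := one_pow p
  map_mul' a b := mul_pow a b p
  map_zero' := zero_pow (Fact.out : p.Prime).ne_zero
  map_add' := add_pow_of_prime_eq_zero p hp

@[simp] theorem frob_apply (p : ℕ) [Fact p.Prime] {A : Type*} [CommRing A] (hp : (p : A) = 0)
    (a : A) : frob p A hp a = a ^ p := rfl

theorem natCast_eq_zero_of_algebra (p : ℕ) (A : Type*) {B : Type*} [CommRing A] [CommRing B]
    [Algebra A B] (hp : (p : A) = 0) : (p : B) = 0 := by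
  rw [← map_natCast (algebraMap A B), hp, map_zero]

/-! ## Local cohomology via the Čech complex -/

namespace Cech

variable {A : Type*} [CommRing A] {m : ℕ} (x : Fin m → A)

/-- The localization `A_{x_σ}`, where `x_σ = ∏_{j ∈ σ} x_j`. -/
abbrev Loc (σ : Finset (Fin m)) : Type _ := Localization.Away (∏ j ∈ σ, x j)

theorem isUnit_of_subset {σ τ : Finset (Fin m)} (h : σ ⊆ τ) :
    IsUnit (algebraMap A (Loc x τ) (∏ j ∈ σ, x j)) :=
  isUnit_of_dvd_unit (map_dvd _ (Finset.prod_dvd_prod_of_subset σ τ x h))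
    (IsLocalization.Away.algebraMap_isUnit _)

/-- The canonical map `A_{x_σ} → A_{x_τ}` for `σ ⊆ τ`. -/
noncomputable def res {σ τ : Finset (Fin m)} (h : σ ⊆ τ) : Loc x σ →ₐ[A] Loc x τ :=
  IsLocalization.liftAlgHom (M := Submonoid.powers (∏ j ∈ σ, x j))
    (f := Algebra.ofId A (Loc x τ)) (by
      rintro ⟨_, N, rfl⟩
      simpa [Algebra.ofId_apply] using (isUnit_of_subset x h).pow N)

/-- The `i`-th term `C^i = ∏_{|σ| = i} A_{x_σ}` of the Čech complex of `A` on `x`. -/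
abbrev C (i : ℕ) : Type _ := ∀ σ : {σ : Finset (Fin m) // σ.card = i}, Loc x σ.1

/-- The Čech differential: the `σ`-component of `d α` is
`∑_{j ∈ σ} (-1)^{#{l ∈ σ | l < j}} α_{σ ∖ {j}}`. -/
noncomputable def d (i : ℕ) : C x i →ₗ[A] C x (i + 1) :=
  LinearMap.pi fun σ => ∑ j : {j // j ∈ σ.1},
    ((-1 : A) ^ (σ.1.filter (· < j.1)).card) •
      ((res x (Finset.erase_subset j.1 σ.1)).toLinearMap ∘ₗ
        LinearMap.proj (⟨σ.1.erase j.1, by rw [Finset.card_erase_of_mem j.2, σ.2]; rfl⟩ :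
          {σ : Finset (Fin m) // σ.card = i}))

/-- Čech cocycles. -/
noncomputable abbrev Z (i : ℕ) : Submodule A (C x i) := LinearMap.ker (d x i)

/-- Čech coboundaries. -/
noncomputable def B : (i : ℕ) → Submodule A (C x i)
  | 0 => ⊥
  | i + 1 => LinearMap.range (d x i)

/-- The `i`-th local cohomology module of `A` with support in the ideal generated by the `x_j`,
as the `i`-th cohomology of the Čech complex of `A` on `x`. -/
abbrev H (i : ℕ) : Type _ := Z x i ⧸ (B x i).submoduleOf (Z x i)

/-! ### The Frobenius action -/

variable (p : ℕ) [Fact p.Prime] (hp : (p : A) = 0)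

/-- The Frobenius on Čech cochains: the Frobenius of the ring `A_{x_σ}` on each component. -/
noncomputable def frobC (i : ℕ) : C x i →ₛₗ[frob p A hp] C x i where
  toFun α σ := frob p (Loc x σ.1) (natCast_eq_zero_of_algebra p A hp) (α σ)
  map_add' α β := by ext σ; simp only [Pi.add_apply, map_add]
  map_smul' a α := by
    ext σ
    simp only [Pi.smul_apply, frob_apply, smul_pow]

theorem d_frobC (i : ℕ) (α : C x i) :
    d x i (frobC x p hp i α) = frobC x p hp (i + 1) (d x i α) := by
  ext σ
  change _ = frob p (Loc x σ.1) (natCast_eq_zero_of_algebra p A hp) (d x i α σ)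
  simp only [d, LinearMap.pi_apply, LinearMap.sum_apply, map_sum]
  refine Finset.sum_congr rfl fun j _ => ?_
  have h : ∀ N : ℕ, ((-1 : A) ^ N) ^ p = (-1) ^ N := fun N => by
    rw [← frob_apply p hp ((-1) ^ N), map_pow, map_neg, map_one]
  simp [frobC, smul_pow, h]

theorem frobC_mem_Z (i : ℕ) (α : Z x i) : frobC x p hp i α ∈ Z x i := by
  rw [LinearMap.mem_ker, d_frobC, α.2, map_zero]

theorem frobC_mem_B (i : ℕ) {α : C x i} (hα : α ∈ B x i) : frobC x p hp i α ∈ B x i := by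
  cases i with
  | zero =>
    rw [B, Submodule.mem_bot] at hα ⊢
    rw [hα, map_zero]
  | succ i =>
    obtain ⟨β, rfl⟩ := hα
    exact ⟨frobC x p hp i β, d_frobC x p hp i β⟩

/-- The Frobenius on Čech cocycles. -/
noncomputable def frobZ (i : ℕ) : Z x i →ₛₗ[frob p A hp] Z x i :=
  ((frobC x p hp i).comp (Z x i).subtype).codRestrict (Z x i) (frobC_mem_Z x p hp i)

/-- The Frobenius action on local cohomology, a `p`-linear map. -/
noncomputable def frobH (i : ℕ) : H x i →ₛₗ[frob p A hp] H x i :=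
  Submodule.mapQ _ _ (frobZ x p hp i) fun _ hα => frobC_mem_B x p hp i hα

/-! ### The grading

`A` is `ℕ`-graded with components `𝒜 e`, and the `x_j` are thought of as homogeneous of degree one.
-/

variable (𝒜 : ℕ → AddSubgroup A)

/-- The component of degree `t` of `A_{x_σ}`: fractions `g / x_σ ^ N` with `g` homogeneous
of degree `t + N |σ|`. -/
def locDeg (σ : Finset (Fin m)) (t : ℤ) : AddSubgroup (Loc x σ) :=
  AddSubgroup.closure {a | ∃ (N e : ℕ) (g : A), g ∈ 𝒜 e ∧ (e : ℤ) = t + N * σ.card ∧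
    a * algebraMap A (Loc x σ) (∏ j ∈ σ, x j) ^ N = algebraMap A (Loc x σ) g}

/-- The component of degree `t` of the cocycles: those all of whose components
have degree `t`. -/
noncomputable def ZDeg (i : ℕ) (t : ℤ) : AddSubgroup (Z x i) :=
  (AddSubgroup.pi Set.univ fun σ : {σ : Finset (Fin m) // σ.card = i} =>
    locDeg x 𝒜 σ.1 t).comap (Z x i).subtype.toAddMonoidHom

/-- The component of degree `t` of local cohomology: classes of cocycles of degree `t`. -/
noncomputable def HDeg (i : ℕ) (t : ℤ) : AddSubgroup (H x i) :=
  (ZDeg x 𝒜 i t).map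
    (Submodule.mkQ ((B x i).submoduleOf (Z x i))).toAddMonoidHom

/-- `H_{< N}`, the sum of all components of degree less than `N`. -/
noncomputable def HLT (i : ℕ) (N : ℤ) : AddSubgroup (H x i) := ⨆ t : {t : ℤ // t < N}, HDeg x 𝒜 i t.1

theorem frob_mem_locDeg [SetLike.GradedMonoid 𝒜] (σ : Finset (Fin m)) (t : ℤ) {a : Loc x σ}
    (ha : a ∈ locDeg x 𝒜 σ t) :
    frob p (Loc x σ) (natCast_eq_zero_of_algebra p A hp) a ∈ locDeg x 𝒜 σ (p * t) := by
  suffices h : locDeg x 𝒜 σ t ≤ (locDeg x 𝒜 σ (p * t)).comap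
      (frob p (Loc x σ) (natCast_eq_zero_of_algebra p A hp)).toAddMonoidHom from h ha
  refine (AddSubgroup.closure_le _).2 ?_
  rintro a ⟨N, e, g, hg, he, hag⟩
  refine AddSubgroup.subset_closure ⟨p * N, p * e, g ^ p, ?_, ?_, ?_⟩
  · simpa using SetLike.pow_mem_graded p hg
  · push_cast
    rw [he]
    ring
  · change a ^ p * _ = _
    rw [map_pow, ← hag, mul_pow, ← pow_mul, mul_comm p N]

theorem frobH_mem_HDeg [SetLike.GradedMonoid 𝒜] (i : ℕ) (t : ℤ) {z : H x i}
    (hz : z ∈ HDeg x 𝒜 i t) : frobH x p hp i z ∈ HDeg x 𝒜 i (p * t) := by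
  obtain ⟨α, hα, rfl⟩ := hz
  exact ⟨frobZ x p hp i α, fun σ hσ => frob_mem_locDeg x p hp 𝒜 σ.1 t (hα σ hσ), rfl⟩

theorem frobH_mem_HLT [SetLike.GradedMonoid 𝒜] (i : ℕ) (N : ℤ) {z : H x i}
    (hz : z ∈ HLT x 𝒜 i N) : frobH x p hp i z ∈ HLT x 𝒜 i (p * N) := by
  suffices h : HLT x 𝒜 i N ≤
      (HLT x 𝒜 i (p * N)).comap (frobH x p hp i).toAddMonoidHom from h hz
  refine iSup_le fun t z hz => ?_
  have hlt : (p : ℤ) * t.1 < p * N :=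
    mul_lt_mul_of_pos_left t.2 (by exact_mod_cast (Fact.out : p.Prime).pos)
  exact le_iSup (fun s : {s : ℤ // s < p * N} => HDeg x 𝒜 i s.1) ⟨p * t.1, hlt⟩
    (frobH_mem_HDeg x p hp 𝒜 i t.1 hz)

/-- The Frobenius action `F : H_{< N} → H_{< pN}`. -/
noncomputable def frobHLT [SetLike.GradedMonoid 𝒜] (i : ℕ) (N : ℤ) :
    HLT x 𝒜 i N →+ HLT x 𝒜 i (p * N) :=
  ((frobH x p hp i).toAddMonoidHom.comp (HLT x 𝒜 i N).subtype).codRestrict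
    (HLT x 𝒜 i (p * N)) fun z => frobH_mem_HLT x p hp 𝒜 i N z.2

end Cech

/-! ## Graded quotients of polynomial rings -/

/-- The degree `e` component of `S / J`, `S` a polynomial ring: residue classes of forms of
degree `e`. -/
noncomputable def quotDeg {k : Type*} [Field k] {n : ℕ} (J : Ideal (MvPolynomial (Fin (n + 1)) k))
    (e : ℕ) : AddSubgroup (MvPolynomial (Fin (n + 1)) k ⧸ J) :=
  (homogeneousSubmodule (Fin (n + 1)) k e).toAddSubgroup.map (Ideal.Quotient.mk J).toAddMonoidHom

instance quotDeg_gradedMonoid {k : Type*} [Field k] {n : ℕ}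
    (J : Ideal (MvPolynomial (Fin (n + 1)) k)) : SetLike.GradedMonoid (quotDeg J) where
  one_mem := ⟨1, isHomogeneous_one _ _, rfl⟩
  mul_mem := by
    rintro i j _ _ ⟨a, ha, rfl⟩ ⟨b, hb, rfl⟩
    exact ⟨a * b, IsHomogeneous.mul ha hb, map_mul (Ideal.Quotient.mk J) a b⟩

theorem quot_natCast_eq_zero {k : Type*} [Field k] (p : ℕ) [CharP k p] {n : ℕ}
    (J : Ideal (MvPolynomial (Fin (n + 1)) k)) :
    (p : MvPolynomial (Fin (n + 1)) k ⧸ J) = 0 :=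
  natCast_eq_zero_of_algebra p k (CharP.cast_eq_zero k p)

/-- The Frobenius action `F : H^i_𝔪(S/J)_{< N} → H^i_𝔪(S/J)_{< pN}`, where
`S = k[x_0, …, x_n]` and `𝔪 = (x_0, …, x_n)`. -/
noncomputable def frobeniusAction {k : Type*} [Field k] (p : ℕ) [Fact p.Prime] [CharP k p] {n : ℕ}
    (J : Ideal (MvPolynomial (Fin (n + 1)) k)) (i : ℕ) (N : ℤ) :
    Cech.HLT (fun j => Ideal.Quotient.mk J (X j)) (quotDeg J) i N →+
      Cech.HLT (fun j => Ideal.Quotient.mk J (X j)) (quotDeg J) i (p * N) :=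
  Cech.frobHLT (fun j => Ideal.Quotient.mk J (X j)) p (quot_natCast_eq_zero p J) (quotDeg J) i N

/-! ## The ideal `τ` -/

/-- The Frobenius power `I^{[p]} = (a^p | a ∈ I)`. -/
def Ideal.frobPow {A : Type*} [CommRing A] (p : ℕ) (I : Ideal A) : Ideal A :=
  Ideal.span ((fun a => a ^ p) '' (I : Set A))

/-- The ideals `I` with `(f_1, …, f_c) ⊆ I` and `(f_1 ⋯ f_c)^{p-1} ∈ I^{[p]}`. -/
def tauSet {A : Type*} [CommRing A] (p : ℕ) {c : ℕ} (f : Fin c → A) : Set (Ideal A) :=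
  {I | Ideal.span (Set.range f) ≤ I ∧ (∏ j, f j) ^ (p - 1) ∈ I.frobPow p}

/-- `τ`, the smallest member of `tauSet p f` (when there is one), as the intersection of
all members. -/
noncomputable def tau {A : Type*} [CommRing A] (p : ℕ) {c : ℕ} (f : Fin c → A) : Ideal A :=
  sInf (tauSet p f)

/-! Top local cohomology of S = k[x_0, …, x_n] is the module of Laurent polynomials modulo those
without monomials with all exponents negative, and Frobenius acts on it by l ↦ l ^ p. If g is a form
regular on S/J, the sequence 0 → S/J → S/J → S/(J + g) → 0 has a connecting map that embeds the
first possibly nonzero local cohomology of S/(J + g) into that of S/J, one index higher. Its image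
is the annihilator of g, it lowers degrees by deg g, and it turns F into g ^ (p - 1) F. After c
steps H^{n+1-c}(R) becomes the annihilator of J in the top cohomology of S, with degrees shifted by
d and F replaced by (f_1 ⋯ f_c) ^ (p - 1) F (`DualityMap`, `nonempty_dualityMap`).

A basis e_b of k over k^p yields generators e_b x^c, 0 ≤ c_j < p, of S over S^p. The f_j and the
coordinates of (f_1 ⋯ f_c) ^ (p - 1) generate τ (`isLeast_tauSet`), and the kernel of the twisted
Frobenius on the annihilator of J is the annihilator of τ (`smul_frobTop_eq_zero_iff`). So
injectivity means that no nonzero class of degree below -(n+1-c)d - d is killed by τ.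

If τ contains no power of some variable, graded duality produces nonzero classes killed by τ in
arbitrarily low degrees (`exists_ne_zero_of_notMem`). If √τ = 𝔪, then, as τ is generated in degrees
at most d, over an infinite field it contains n+1-c forms of degree exactly d that prolong the
regular sequence. Dividing by these moves a class killed by τ into H^0 of a quotient of S; in the
range at hand it has negative degree there, so it vanishes (`DualityMap.eq_zero_of_infinite`). Base
change to the algebraic closure covers finite fields. -/

namespace Cech

/-! ### Localizations at products of the elements -/

section Localization

variable {A : Type*} [CommRing A] {m : ℕ} (x : Fin m → A)

theorem isUnit_prod (σ : Finset (Fin m)) : IsUnit (algebraMap A (Loc x σ) (∏ j ∈ σ, x j)) :=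
  IsLocalization.Away.algebraMap_isUnit _

theorem exists_mul_inverse_pow (σ : Finset (Fin m)) (N : ℕ) :
    ∃ v : Loc x σ, algebraMap A (Loc x σ) (∏ j ∈ σ, x j) ^ N * v = 1 :=
  ((isUnit_prod x σ).pow N).exists_right_inv

theorem mul_prod_pow_cancel {σ : Finset (Fin m)} {N : ℕ} {a b : Loc x σ}
    (h : a * algebraMap A (Loc x σ) (∏ j ∈ σ, x j) ^ N
      = b * algebraMap A (Loc x σ) (∏ j ∈ σ, x j) ^ N) : a = b :=
  ((isUnit_prod x σ).pow N).mul_right_cancel h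

theorem algebraMap_eq_zero_iff (σ : Finset (Fin m)) (a : A) :
    algebraMap A (Loc x σ) a = 0 ↔ ∃ N : ℕ, (∏ j ∈ σ, x j) ^ N * a = 0 := by
  rw [IsLocalization.map_eq_zero_iff (Submonoid.powers (∏ j ∈ σ, x j))]
  constructor
  · rintro ⟨⟨_, N, rfl⟩, h⟩
    exact ⟨N, h⟩
  · rintro ⟨N, h⟩
    exact ⟨⟨_, N, rfl⟩, h⟩

theorem smul_eq_zero_of_regular {g : A} (hg : ∀ a, g * a = 0 → a = 0) {σ : Finset (Fin m)}
    {a : Loc x σ} (h : g • a = 0) : a = 0 := by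
  obtain ⟨N, a₀, ha⟩ := IsLocalization.Away.surj (∏ j ∈ σ, x j) a
  have h1 : algebraMap A (Loc x σ) (g * a₀) = 0 := by
    rw [map_mul, ← ha, ← mul_assoc, ← Algebra.smul_def, h, zero_mul]
  obtain ⟨M, hM⟩ := (algebraMap_eq_zero_iff x σ _).1 h1
  have h2 : algebraMap A (Loc x σ) a₀ = 0 :=
    (algebraMap_eq_zero_iff x σ _).2 ⟨M, hg _ (by rw [← hM]; ring)⟩
  refine mul_prod_pow_cancel x (N := N) ?_
  rw [ha, h2, zero_mul]

@[simp] theorem res_algebraMap {σ τ : Finset (Fin m)} (h : σ ⊆ τ) (a : A) :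
    res x h (algebraMap A _ a) = algebraMap A _ a := AlgHom.commutes _ _

theorem d_apply (i : ℕ) (α : C x i) (σ : {σ : Finset (Fin m) // σ.card = i + 1}) :
    d x i α σ = ∑ j : {j // j ∈ σ.1}, ((-1 : A) ^ (σ.1.filter (· < j.1)).card) •
      res x (Finset.erase_subset j.1 σ.1)
        (α ⟨σ.1.erase j.1, by rw [Finset.card_erase_of_mem j.2, σ.2]; rfl⟩) := by
  simp [d]

end Localization

/-! ### Functoriality of the Čech complex, and exactness for a quotient by a nonzerodivisor -/

section Functoriality

variable {A A' : Type*} [CommRing A] [CommRing A'] {m : ℕ} {x : Fin m → A} {x' : Fin m → A'}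
  (π : A →+* A') (hx : ∀ j, π (x j) = x' j)

include hx in
theorem map_prod_eq (σ : Finset (Fin m)) : π (∏ j ∈ σ, x j) = ∏ j ∈ σ, x' j := by
  simp [map_prod, hx]

/-- The map induced on localizations by a ring homomorphism. -/
noncomputable def locMap (σ : Finset (Fin m)) : Loc x σ →+* Loc x' σ :=
  IsLocalization.Away.lift (∏ j ∈ σ, x j) (g := (algebraMap A' (Loc x' σ)).comp π) (by
    rw [RingHom.comp_apply, map_prod_eq π hx]
    exact isUnit_prod x' σ)

@[simp] theorem locMap_algebraMap (σ : Finset (Fin m)) (a : A) :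
    locMap π hx σ (algebraMap A _ a) = algebraMap A' _ (π a) :=
  IsLocalization.Away.lift_eq _ _ a

theorem locMap_prod (σ : Finset (Fin m)) :
    locMap π hx σ (algebraMap A _ (∏ j ∈ σ, x j)) = algebraMap A' _ (∏ j ∈ σ, x' j) := by
  rw [locMap_algebraMap, map_prod_eq π hx]

theorem locMap_res {σ τ : Finset (Fin m)} (h : σ ⊆ τ) (a : Loc x σ) :
    locMap π hx τ (res x h a) = res x' h (locMap π hx σ a) := by
  have : (locMap π hx τ).comp (res x h).toRingHom = (res x' h).toRingHom.comp (locMap π hx σ) := by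
    refine IsLocalization.ringHom_ext (Submonoid.powers (∏ j ∈ σ, x j)) ?_
    ext a
    simp
  exact congrArg (fun f => f a) this

theorem locMap_smul (σ : Finset (Fin m)) (r : A) (a : Loc x σ) :
    locMap π hx σ (r • a) = π r • locMap π hx σ a := by
  rw [Algebra.smul_def, map_mul, locMap_algebraMap, Algebra.smul_def]

theorem locMap_surjective (hπ : Function.Surjective π) (σ : Finset (Fin m)) :
    Function.Surjective (locMap π hx σ) := by
  intro a'
  obtain ⟨N, a₀, ha⟩ := IsLocalization.Away.surj (∏ j ∈ σ, x' j) a'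
  obtain ⟨a₁, rfl⟩ := hπ a₀
  obtain ⟨v, hv⟩ := exists_mul_inverse_pow x σ N
  refine ⟨algebraMap A _ a₁ * v, mul_prod_pow_cancel x' (N := N) ?_⟩
  rw [ha, ← locMap_prod π hx, ← map_pow, ← map_mul, mul_assoc, mul_comm v, hv, mul_one,
    locMap_algebraMap]

theorem exists_smul_of_locMap_eq_zero {g : A} (hker : ∀ a, π a = 0 → ∃ b, a = g * b)
    {σ : Finset (Fin m)} {a : Loc x σ} (h : locMap π hx σ a = 0) : ∃ b, a = g • b := by
  obtain ⟨N, a₀, ha⟩ := IsLocalization.Away.surj (∏ j ∈ σ, x j) a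
  have h1 : algebraMap A' (Loc x' σ) (π a₀) = 0 := by
    rw [← locMap_algebraMap π hx, ← ha, map_mul, h, zero_mul]
  obtain ⟨M, hM⟩ := (algebraMap_eq_zero_iff x' σ _).1 h1
  -- The numerator maps to zero only in the localization of `A'`; the factor with exponent `M` makes
  -- it vanish in `A'` itself and is then absorbed in the denominator.
  obtain ⟨b, hb⟩ := hker ((∏ j ∈ σ, x j) ^ M * a₀) (by
    rw [map_mul, map_pow, map_prod_eq π hx, hM])
  obtain ⟨v, hv⟩ := exists_mul_inverse_pow x σ (N + M)
  refine ⟨algebraMap A _ b * v, mul_prod_pow_cancel x (N := N + M) ?_⟩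
  rw [smul_mul_assoc, mul_assoc, mul_comm v, hv, mul_one, Algebra.smul_def, ← map_mul, ← hb,
    map_mul, ← ha, map_pow]
  ring

/-- The map induced on Čech cochains by a ring homomorphism. -/
noncomputable def cmap (i : ℕ) : C x i →+ C x' i where
  toFun α σ := locMap π hx σ.1 (α σ)
  map_zero' := by ext; simp
  map_add' _ _ := by ext; simp

@[simp] theorem cmap_apply (i : ℕ) (α : C x i) (σ : {σ : Finset (Fin m) // σ.card = i}) :
    cmap π hx i α σ = locMap π hx σ.1 (α σ) := rfl

theorem cmap_smul (i : ℕ) (r : A) (α : C x i) : cmap π hx i (r • α) = π r • cmap π hx i α := by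
  ext σ
  exact locMap_smul π hx σ.1 r (α σ)

theorem d_cmap (i : ℕ) (α : C x i) : d x' i (cmap π hx i α) = cmap π hx (i + 1) (d x i α) := by
  ext σ
  rw [cmap_apply, d_apply, d_apply, map_sum]
  refine Finset.sum_congr rfl fun j _ => ?_
  rw [locMap_smul, locMap_res, map_pow, map_neg, map_one, cmap_apply]

theorem cmap_surjective (hπ : Function.Surjective π) (i : ℕ) :
    Function.Surjective (cmap π hx i) := by
  intro α'
  choose a ha using fun σ : {σ : Finset (Fin m) // σ.card = i} =>
    locMap_surjective π hx hπ σ.1 (α' σ)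
  exact ⟨a, funext ha⟩

theorem exists_smul_of_cmap_eq_zero {g : A} (hker : ∀ a, π a = 0 → ∃ b, a = g * b)
    {i : ℕ} {α : C x i} (h : cmap π hx i α = 0) : ∃ β, α = g • β := by
  choose b hb using fun σ : {σ : Finset (Fin m) // σ.card = i} =>
    exists_smul_of_locMap_eq_zero π hx hker (congrFun h σ)
  exact ⟨b, funext hb⟩

theorem cochain_smul_eq_zero {g : A} (hg : ∀ a, g * a = 0 → a = 0) {i : ℕ} {α : C x i}
    (h : g • α = 0) : α = 0 :=
  funext fun σ => smul_eq_zero_of_regular x hg (congrFun h σ)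

theorem cmap_frobC (p : ℕ) [Fact p.Prime] (hp : (p : A) = 0) (hp' : (p : A') = 0)
    (i : ℕ) (α : C x i) :
    cmap π hx i (frobC x p hp i α) = frobC x' p hp' i (cmap π hx i α) := by
  ext σ
  exact map_pow (locMap π hx σ.1) (α σ) p

end Functoriality

/-! ### The grading of localizations and cochains -/

section Grading

variable {A : Type*} [CommRing A] {m : ℕ} (x : Fin m → A) (𝒜 : ℕ → AddSubgroup A)

/-- A coaction of `ℤ[T;T⁻¹]` on `A` that encodes an `ℕ`-grading in which the `x_j` have
degree one. -/
structure Coaction [SetLike.GradedMonoid 𝒜] where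
  toHom : A →+* AddMonoidAlgebra A ℤ
  apply_of_mem : ∀ {e a}, a ∈ 𝒜 e → toHom a = AddMonoidAlgebra.single (e : ℤ) a
  iSup_eq_top : ⨆ e, 𝒜 e = ⊤
  mem_one : ∀ j, x j ∈ 𝒜 1

variable {x 𝒜} [SetLike.GradedMonoid 𝒜] (ρ : Coaction x 𝒜)

include ρ in
theorem Coaction.prod_mem (σ : Finset (Fin m)) : ∏ j ∈ σ, x j ∈ 𝒜 σ.card := by
  classical
  induction σ using Finset.induction_on with
  | empty => simpa using SetLike.GradedOne.one_mem
  | insert a s ha ih =>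
    rw [Finset.prod_insert ha, Finset.card_insert_of_notMem ha, add_comm]
    exact SetLike.GradedMul.mul_mem (ρ.mem_one a) ih

include ρ in
theorem Coaction.prod_pow_mem (σ : Finset (Fin m)) (N : ℕ) :
    (∏ j ∈ σ, x j) ^ N ∈ 𝒜 (N * σ.card) := by
  simpa using SetLike.pow_mem_graded N (ρ.prod_mem σ)

theorem isUnit_single {B : Type*} [CommRing B] {b : B} (hb : IsUnit b) (t : ℤ) :
    IsUnit (AddMonoidAlgebra.single t b) := by
  obtain ⟨c, hc⟩ := hb.exists_right_inv
  refine IsUnit.of_mul_eq_one (AddMonoidAlgebra.single (-t) c) ?_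
  rw [AddMonoidAlgebra.single_mul_single, hc, add_neg_cancel]
  rfl

/-- The coaction on the localization. -/
noncomputable def Coaction.loc (σ : Finset (Fin m)) :
    Loc x σ →+* AddMonoidAlgebra (Loc x σ) ℤ :=
  IsLocalization.Away.lift (∏ j ∈ σ, x j)
    (g := (AddMonoidAlgebra.mapRingHom ℤ (algebraMap A (Loc x σ))).comp ρ.toHom) (by
      rw [RingHom.comp_apply, ρ.apply_of_mem (ρ.prod_mem σ), AddMonoidAlgebra.mapRingHom_single]
      exact isUnit_single (isUnit_prod x σ) _)

theorem Coaction.loc_algebraMap (σ : Finset (Fin m)) {e : ℕ} {a : A} (ha : a ∈ 𝒜 e) :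
    ρ.loc σ (algebraMap A _ a) = AddMonoidAlgebra.single (e : ℤ) (algebraMap A _ a) := by
  rw [Coaction.loc, IsLocalization.Away.lift_eq, RingHom.comp_apply, ρ.apply_of_mem ha,
    AddMonoidAlgebra.mapRingHom_single]

/-- The definition of `locDeg` as a closure does not show that different degrees are independent.
The coaction separates them by the power of T, which is what makes projections to components
available. -/
theorem Coaction.loc_of_mem {σ : Finset (Fin m)} {t : ℤ} {a : Loc x σ}
    (ha : a ∈ locDeg x 𝒜 σ t) : ρ.loc σ a = AddMonoidAlgebra.single t a := by
  induction ha using AddSubgroup.closure_induction with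
  | zero => simp
  | add a b _ _ ha hb => rw [map_add, ha, hb, AddMonoidAlgebra.single_add]
  | neg a _ ha => rw [map_neg, ha, AddMonoidAlgebra.single_neg]
  | mem a ha =>
    obtain ⟨N, e, g, hg, he, h⟩ := ha
    have h1 := ρ.loc_algebraMap σ hg
    have h2 := ρ.loc_algebraMap σ (ρ.prod_pow_mem σ N)
    have hu : IsUnit (ρ.loc σ (algebraMap A _ ((∏ j ∈ σ, x j) ^ N))) := by
      rw [map_pow]
      exact ((isUnit_prod x σ).pow N).map _
    refine hu.mul_right_cancel ?_
    rw [← map_mul, map_pow, h, h1, ← h, ← map_pow, h2, AddMonoidAlgebra.single_mul_single, map_pow,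
      he]
    push_cast
    rfl

omit [SetLike.GradedMonoid 𝒜] in
theorem algebraMap_mul_inverse_mem_locDeg {σ : Finset (Fin m)} {e N : ℕ} {g : A} (hg : g ∈ 𝒜 e)
    {v : Loc x σ} (hv : algebraMap A (Loc x σ) (∏ j ∈ σ, x j) ^ N * v = 1) :
    algebraMap A _ g * v ∈ locDeg x 𝒜 σ (e - N * σ.card) := by
  refine AddSubgroup.subset_closure ⟨N, e, g, hg, by ring, ?_⟩
  rw [mul_assoc, mul_comm v, hv, mul_one]

include ρ in
theorem Coaction.iSup_locDeg (σ : Finset (Fin m)) : ⨆ t, locDeg x 𝒜 σ t = ⊤ := by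
  refine (AddSubgroup.eq_top_iff' _).2 fun a => ?_
  obtain ⟨N, a₀, ha⟩ := IsLocalization.Away.surj (∏ j ∈ σ, x j) a
  obtain ⟨v, hv⟩ := exists_mul_inverse_pow x σ N
  have : a = algebraMap A _ a₀ * v := by rw [← ha, mul_assoc, hv, mul_one]
  rw [this]
  have h0 : a₀ ∈ ⨆ e, 𝒜 e := by rw [ρ.iSup_eq_top]; trivial
  refine AddSubgroup.iSup_induction 𝒜
    (C := fun a₀ => algebraMap A _ a₀ * v ∈ ⨆ t, locDeg x 𝒜 σ t) h0 (fun e g hg =>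
      AddSubgroup.mem_iSup_of_mem _ (algebraMap_mul_inverse_mem_locDeg hg hv)) ?_ ?_
  · rw [map_zero, zero_mul]
    exact zero_mem _
  · intro a b ha hb
    rw [map_add, add_mul]
    exact add_mem ha hb

/-- The projection of the localization to its component of degree `t`. -/
noncomputable def Coaction.proj (σ : Finset (Fin m)) (t : ℤ) : Loc x σ →+ Loc x σ where
  toFun a := (ρ.loc σ a).coeff t
  map_zero' := by simp
  map_add' a b := by simp

theorem Coaction.proj_of_mem {σ : Finset (Fin m)} {s : ℤ} (t : ℤ) {a : Loc x σ}
    (ha : a ∈ locDeg x 𝒜 σ s) : ρ.proj σ t a = if s = t then a else 0 := by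
  change (ρ.loc σ a).coeff t = _
  rw [ρ.loc_of_mem ha]
  simp [Finsupp.single_apply, -LaurentPolynomial.single_eq_C_mul_T]

theorem Coaction.loc_induction (ρ : Coaction x 𝒜) {σ : Finset (Fin m)} {P : Loc x σ → Prop} (h0 : P 0)
    (hadd : ∀ a b, P a → P b → P (a + b)) (hdeg : ∀ s, ∀ a ∈ locDeg x 𝒜 σ s, P a)
    (a : Loc x σ) : P a := by
  have h : a ∈ ⨆ t, locDeg x 𝒜 σ t := by rw [ρ.iSup_locDeg]; trivial
  exact AddSubgroup.iSup_induction _ (C := P) h hdeg h0 hadd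

theorem Coaction.proj_mem (σ : Finset (Fin m)) (t : ℤ) (a : Loc x σ) :
    ρ.proj σ t a ∈ locDeg x 𝒜 σ t := by
  induction a using ρ.loc_induction with
  | h0 => rw [map_zero]; exact zero_mem _
  | hadd a b ha hb => rw [map_add]; exact add_mem ha hb
  | hdeg s a ha =>
    rw [ρ.proj_of_mem t ha]
    split_ifs with h
    · exact h ▸ ha
    · exact zero_mem _

theorem Coaction.proj_self {σ : Finset (Fin m)} {t : ℤ} {a : Loc x σ}
    (ha : a ∈ locDeg x 𝒜 σ t) : ρ.proj σ t a = a := by rw [ρ.proj_of_mem t ha, if_pos rfl]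

include ρ in
theorem Coaction.res_mem {σ τ : Finset (Fin m)} (h : σ ⊆ τ) {t : ℤ} {a : Loc x σ}
    (ha : a ∈ locDeg x 𝒜 σ t) : res x h a ∈ locDeg x 𝒜 τ t := by
  induction ha using AddSubgroup.closure_induction with
  | zero => rw [map_zero]; exact zero_mem _
  | add a b _ _ ha hb => rw [map_add]; exact add_mem ha hb
  | neg a _ ha => rw [map_neg]; exact neg_mem ha
  | mem a ha =>
    obtain ⟨N, e, g, hg, he, hag⟩ := ha
    -- Numerator and denominator are both multiplied by the `N`-th power of the product over τ ∖ σ.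
    refine AddSubgroup.subset_closure ⟨N, e + N * (τ \ σ).card, g * (∏ j ∈ τ \ σ, x j) ^ N,
      SetLike.GradedMul.mul_mem hg (ρ.prod_pow_mem _ N), ?_, ?_⟩
    · have : (τ \ σ).card + σ.card = τ.card := Finset.card_sdiff_add_card_eq_card h
      rw [← this]
      push_cast
      rw [he]
      ring
    · have hs := congrArg (algebraMap A (Loc x τ)) (Finset.prod_sdiff (f := x) h)
      rw [← hs, map_mul, map_mul, map_pow, mul_pow, ← res_algebraMap x h g, ← hag,
        map_mul, map_pow, res_algebraMap]
      ring

theorem smul_mem_locDeg {δ : ℕ} {g : A} (hg : g ∈ 𝒜 δ) {σ : Finset (Fin m)} {t : ℤ} {a : Loc x σ}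
    (ha : a ∈ locDeg x 𝒜 σ t) : g • a ∈ locDeg x 𝒜 σ (t + δ) := by
  induction ha using AddSubgroup.closure_induction with
  | zero => rw [smul_zero]; exact zero_mem _
  | add a b _ _ ha hb => rw [smul_add]; exact add_mem ha hb
  | neg a _ ha => rw [smul_neg]; exact neg_mem ha
  | mem a ha =>
    obtain ⟨N, e, h, hh, he, hah⟩ := ha
    refine AddSubgroup.subset_closure ⟨N, δ + e, g * h, SetLike.GradedMul.mul_mem hg hh, ?_, ?_⟩
    · push_cast
      rw [he]
      ring
    · rw [map_mul, ← hah, Algebra.smul_def, mul_assoc]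

theorem Coaction.proj_res {σ τ : Finset (Fin m)} (h : σ ⊆ τ) (t : ℤ) (a : Loc x σ) :
    ρ.proj τ t (res x h a) = res x h (ρ.proj σ t a) := by
  induction a using ρ.loc_induction with
  | h0 => simp
  | hadd a b ha hb => simp [ha, hb]
  | hdeg s a ha =>
    rw [ρ.proj_of_mem t ha, ρ.proj_of_mem t (ρ.res_mem h ha)]
    split_ifs <;> simp

theorem Coaction.proj_smul {δ : ℕ} {g : A} (hg : g ∈ 𝒜 δ) (σ : Finset (Fin m)) (t : ℤ)
    (a : Loc x σ) : ρ.proj σ (t + δ) (g • a) = g • ρ.proj σ t a := by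
  induction a using ρ.loc_induction with
  | h0 => simp
  | hadd a b ha hb => simp [ha, hb]
  | hdeg s a ha =>
    rw [ρ.proj_of_mem t ha, ρ.proj_of_mem _ (smul_mem_locDeg hg ha)]
    by_cases h : s = t <;> simp [h]

/-- The cochains of degree `t`. -/
def CDeg (x : Fin m → A) (𝒜 : ℕ → AddSubgroup A) (i : ℕ) (t : ℤ) : AddSubgroup (C x i) :=
  AddSubgroup.pi Set.univ fun σ : {σ : Finset (Fin m) // σ.card = i} => locDeg x 𝒜 σ.1 t

omit [SetLike.GradedMonoid 𝒜] in
theorem mem_CDeg {i : ℕ} {t : ℤ} {α : C x i} :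
    α ∈ CDeg x 𝒜 i t ↔ ∀ σ, α σ ∈ locDeg x 𝒜 σ.1 t := by
  simp [CDeg, AddSubgroup.mem_pi]

/-- The projection of the cochains to their component of degree `t`. -/
noncomputable def Coaction.cproj (i : ℕ) (t : ℤ) : C x i →+ C x i where
  toFun α σ := ρ.proj σ.1 t (α σ)
  map_zero' := by ext; simp
  map_add' a b := by ext; simp

theorem Coaction.cproj_mem (i : ℕ) (t : ℤ) (α : C x i) : ρ.cproj i t α ∈ CDeg x 𝒜 i t :=
  mem_CDeg.2 fun σ => ρ.proj_mem σ.1 t (α σ)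

theorem Coaction.cproj_self {i : ℕ} {t : ℤ} {α : C x i} (hα : α ∈ CDeg x 𝒜 i t) :
    ρ.cproj i t α = α :=
  funext fun σ => ρ.proj_self (mem_CDeg.1 hα σ)

theorem Coaction.d_cproj (i : ℕ) (t : ℤ) (α : C x i) :
    d x i (ρ.cproj i t α) = ρ.cproj (i + 1) t (d x i α) := by
  ext σ
  change _ = ρ.proj σ.1 t (d x i α σ)
  rw [d_apply, d_apply, map_sum]
  refine Finset.sum_congr rfl fun j _ => ?_
  have h : ∀ (N : ℕ) (σ : Finset (Fin m)) (a : Loc x σ),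
      ρ.proj σ t (((-1 : A) ^ N) • a) = ((-1 : A) ^ N) • ρ.proj σ t a := by
    intro N σ a
    rcases neg_one_pow_eq_or A N with h | h <;> simp [h]
  rw [h, ρ.proj_res]
  rfl

theorem Coaction.cproj_smul {δ : ℕ} {g : A} (hg : g ∈ 𝒜 δ) (i : ℕ) (t : ℤ) (α : C x i) :
    ρ.cproj i (t + δ) (g • α) = g • ρ.cproj i t α :=
  funext fun σ => ρ.proj_smul hg σ.1 t (α σ)

include ρ in
theorem Coaction.d_mem (i : ℕ) {t : ℤ} {α : C x i} (hα : α ∈ CDeg x 𝒜 i t) :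
    d x i α ∈ CDeg x 𝒜 (i + 1) t := by
  rw [← ρ.cproj_self hα, ρ.d_cproj]
  exact ρ.cproj_mem _ _ _

include ρ in
/-- A nonzerodivisor of degree `δ` that carries a cochain to degree `t + δ` carries it
from degree `t`. -/
theorem Coaction.mem_of_smul_mem {δ : ℕ} {g : A} (hg : g ∈ 𝒜 δ) (hreg : ∀ a, g * a = 0 → a = 0)
    {i : ℕ} {t : ℤ} {α : C x i} (h : g • α ∈ CDeg x 𝒜 i (t + δ)) : α ∈ CDeg x 𝒜 i t := by
  have h1 : g • (ρ.cproj i t α - α) = 0 := by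
    rw [smul_sub, ← ρ.cproj_smul hg, ρ.cproj_self h, sub_self]
  rw [← sub_eq_zero.1 (cochain_smul_eq_zero hreg h1)]
  exact ρ.cproj_mem _ _ _

omit [SetLike.GradedMonoid 𝒜] in
theorem exists_locMap_eq_of_mem_locDeg {A' : Type*} [CommRing A'] {x' : Fin m → A'}
    {𝒜' : ℕ → AddSubgroup A'} (π : A →+* A') (hx : ∀ j, π (x j) = x' j)
    (hlift : ∀ e, ∀ a' ∈ 𝒜' e, ∃ a ∈ 𝒜 e, π a = a') {σ : Finset (Fin m)} {t : ℤ} {a' : Loc x' σ}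
    (ha' : a' ∈ locDeg x' 𝒜' σ t) : ∃ a ∈ locDeg x 𝒜 σ t, locMap π hx σ a = a' := by
  induction ha' using AddSubgroup.closure_induction with
  | zero => exact ⟨0, zero_mem _, map_zero _⟩
  | add a b _ _ ha hb =>
    obtain ⟨a, ha, rfl⟩ := ha
    obtain ⟨b, hb, rfl⟩ := hb
    exact ⟨a + b, add_mem ha hb, map_add _ _ _⟩
  | neg a _ ha =>
    obtain ⟨a, ha, rfl⟩ := ha
    exact ⟨-a, neg_mem ha, map_neg _ _⟩
  | mem a' ha' =>
    obtain ⟨N, e, g', hg', he, h⟩ := ha'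
    obtain ⟨g, hg, rfl⟩ := hlift e g' hg'
    obtain ⟨v, hv⟩ := exists_mul_inverse_pow x σ N
    have := algebraMap_mul_inverse_mem_locDeg hg hv
    rw [he, add_sub_cancel_right] at this
    refine ⟨_, this, mul_prod_pow_cancel x' (N := N) ?_⟩
    rw [h, ← locMap_prod π hx, ← map_pow, ← map_mul, mul_assoc, mul_comm v, hv, mul_one,
      locMap_algebraMap]

omit [SetLike.GradedMonoid 𝒜] in
theorem exists_cmap_eq_of_mem_CDeg {A' : Type*} [CommRing A'] {x' : Fin m → A'}
    {𝒜' : ℕ → AddSubgroup A'} (π : A →+* A') (hx : ∀ j, π (x j) = x' j)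
    (hlift : ∀ e, ∀ a' ∈ 𝒜' e, ∃ a ∈ 𝒜 e, π a = a') {i : ℕ} {t : ℤ} {α' : C x' i}
    (hα : α' ∈ CDeg x' 𝒜' i t) : ∃ α ∈ CDeg x 𝒜 i t, cmap π hx i α = α' := by
  choose a ha ha' using fun σ => exists_locMap_eq_of_mem_locDeg π hx hlift (mem_CDeg.1 hα σ)
  exact ⟨a, mem_CDeg.2 ha, funext ha'⟩

end Grading

end Cech

/-! ## Laurent polynomials and the top local cohomology of a polynomial ring -/

/-- The Laurent polynomial ring `k[x_j, x_j⁻¹ | j < m]`. -/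
abbrev MvLaurent (k : Type*) [Field k] (m : ℕ) : Type _ := AddMonoidAlgebra k (Fin m → ℤ)

namespace MvLaurent

open AddMonoidAlgebra (single single_mul_single)

variable {k : Type*} [Field k] {m : ℕ}

/-- A vector of natural numbers as a vector of integers. -/
def expCast (m : ℕ) : (Fin m →₀ ℕ) →+ (Fin m → ℤ) where
  toFun u j := u j
  map_zero' := by ext; simp
  map_add' u v := by ext; simp

@[simp] theorem expCast_apply (u : Fin m →₀ ℕ) (j : Fin m) : expCast m u j = u j := rfl

theorem expCast_injective : Function.Injective (expCast m) := fun u v h => by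
  ext j
  have := congrFun h j
  simpa using this

theorem exists_expCast_eq {a : Fin m → ℤ} (ha : ∀ j, 0 ≤ a j) : ∃ u, expCast m u = a :=
  ⟨Finsupp.equivFunOnFinite.symm fun j => (a j).toNat, by ext j; simp [ha j]⟩

theorem sum_expCast (u : Fin m →₀ ℕ) : ∑ j, expCast m u j = (u.degree : ℤ) := by
  simp [Finsupp.degree_eq_sum]

variable (k m) in
/-- The inclusion of the polynomial ring. -/
noncomputable def ofPoly : MvPolynomial (Fin m) k →+* MvLaurent k m :=
  AddMonoidAlgebra.mapDomainRingHom k (expCast m)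

@[simp] theorem ofPoly_monomial (u : Fin m →₀ ℕ) (r : k) :
    ofPoly k m (monomial u r) = single (expCast m u) r :=
  AddMonoidAlgebra.mapDomain_single

theorem ofPoly_injective : Function.Injective (ofPoly k m) :=
  AddMonoidAlgebra.mapDomain_injective expCast_injective

theorem coeff_ofPoly (s : MvPolynomial (Fin m) k) (u : Fin m →₀ ℕ) :
    (ofPoly k m s).coeff (expCast m u) = MvPolynomial.coeff u s :=
  Finsupp.mapDomain_apply expCast_injective _ _

theorem coeff_ofPoly_of_neg (s : MvPolynomial (Fin m) k) {a : Fin m → ℤ} {j : Fin m}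
    (ha : a j < 0) : (ofPoly k m s).coeff a = 0 := by
  refine Finsupp.mapDomain_of_notMem_range _ _ ?_
  rintro ⟨u, rfl⟩
  simp at ha
  omega

noncomputable instance : Module (MvPolynomial (Fin m) k) (MvLaurent k m) :=
  Module.compHom _ (ofPoly k m)

theorem poly_smul_def (s : MvPolynomial (Fin m) k) (l : MvLaurent k m) :
    s • l = ofPoly k m s * l := rfl

theorem coeff_monomial_smul (u : Fin m →₀ ℕ) (r : k) (l : MvLaurent k m) (a : Fin m → ℤ) :
    (monomial u r • l).coeff a = r * l.coeff (a - expCast m u) := by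
  rw [poly_smul_def, ofPoly_monomial, AddMonoidAlgebra.coeff_single_mul_apply, neg_add_eq_sub]

variable (k m) in
/-- The Laurent polynomials without monomials whose exponents are all negative. -/
noncomputable def nonneg : Submodule (MvPolynomial (Fin m) k) (MvLaurent k m) where
  carrier := {l | ∀ a, (∀ j, a j < 0) → l.coeff a = 0}
  zero_mem' a _ := by simp
  add_mem' {l l'} h h' a ha := by simp [h a ha, h' a ha]
  smul_mem' s l h a ha := by
    -- Multiplication by a monomial only raises exponents, so an all-negative exponent of the
    -- product comes from an all-negative exponent of `l`.
    induction s using MvPolynomial.induction_on' generalizing a with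
    | monomial u r =>
      rw [coeff_monomial_smul, h _ fun j => ?_, mul_zero]
      have := ha j
      simp only [Pi.sub_apply, expCast_apply]
      omega
    | add s t hs ht => rw [add_smul, AddMonoidAlgebra.coeff_add, Finsupp.add_apply, hs a ha,
        ht a ha, add_zero]

theorem mem_nonneg {l : MvLaurent k m} :
    l ∈ nonneg k m ↔ ∀ a, (∀ j, a j < 0) → l.coeff a = 0 := Iff.rfl

variable (k m) in
/-- The homogeneous Laurent polynomials of degree `t`. -/
def deg (t : ℤ) : AddSubgroup (MvLaurent k m) where
  carrier := {l | ∀ a, ∑ j, a j ≠ t → l.coeff a = 0}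
  zero_mem' a _ := by simp
  add_mem' {l l'} h h' a ha := by simp [h a ha, h' a ha]
  neg_mem' {l} h a ha := by simp [h a ha]

theorem single_mem_deg (a : Fin m → ℤ) (r : k) : single a r ∈ deg k m (∑ j, a j) := by
  intro b hb
  simp only [AddMonoidAlgebra.coeff_single]
  rw [Finsupp.single_eq_of_ne]
  rintro rfl
  exact hb rfl

variable (k m) in
/-- The top local cohomology of the polynomial ring, in terms of Laurent polynomials. -/
abbrev Top : Type _ := MvLaurent k m ⧸ nonneg k m

variable (k m) in
/-- The component of degree `t`. -/
noncomputable def topDeg (t : ℤ) : AddSubgroup (Top k m) :=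
  (deg k m t).map (nonneg k m).mkQ.toAddMonoidHom

/-! ### Frobenius -/

section Frobenius

variable (p : ℕ) [Fact p.Prime] [CharP k p]

variable (k m) in
omit [Fact p.Prime] in
theorem natCast_eq_zero : (p : MvLaurent k m) = 0 :=
  natCast_eq_zero_of_algebra p k (CharP.cast_eq_zero k p)

variable (k m) in
omit [Fact p.Prime] in
theorem poly_natCast_eq_zero : (p : MvPolynomial (Fin m) k) = 0 :=
  natCast_eq_zero_of_algebra p k (CharP.cast_eq_zero k p)

theorem add_pow_p (l l' : MvLaurent k m) : (l + l') ^ p = l ^ p + l' ^ p :=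
  add_pow_of_prime_eq_zero p (natCast_eq_zero k m p) l l'

theorem coeff_pow (l : MvLaurent k m) (a : Fin m → ℤ) :
    (l ^ p).coeff (p • a) = l.coeff a ^ p := by
  have hp := (Fact.out : p.Prime)
  induction l using AddMonoidAlgebra.induction_linear with
  | zero => simp [zero_pow hp.ne_zero]
  | add l l' h h' =>
    rw [add_pow_p, AddMonoidAlgebra.coeff_add, Finsupp.add_apply, h, h', AddMonoidAlgebra.coeff_add,
      Finsupp.add_apply, add_pow_char]
  | single b r =>
    rw [AddMonoidAlgebra.single_pow, AddMonoidAlgebra.coeff_single, AddMonoidAlgebra.coeff_single,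
      Finsupp.single_apply, Finsupp.single_apply]
    have : p • b = p • a ↔ b = a := by
      refine ⟨fun h => ?_, fun h => h ▸ rfl⟩
      ext j
      have := congrFun h j
      simpa [hp.ne_zero] using this
    simp only [this]
    split_ifs
    · rfl
    · rw [zero_pow hp.ne_zero]

theorem coeff_pow_of_ne (l : MvLaurent k m) {b : Fin m → ℤ} (hb : ∀ a, p • a ≠ b) :
    (l ^ p).coeff b = 0 := by
  induction l using AddMonoidAlgebra.induction_linear with
  | zero => simp [zero_pow (Fact.out : p.Prime).ne_zero]
  | add l l' h h' =>
    rw [add_pow_p, AddMonoidAlgebra.coeff_add, Finsupp.add_apply, h, h', add_zero]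
  | single a r =>
    rw [AddMonoidAlgebra.single_pow, AddMonoidAlgebra.coeff_single,
      Finsupp.single_eq_of_ne (hb a).symm]

variable (k m) in
/-- The Frobenius of Laurent polynomials. -/
noncomputable def frobL : MvLaurent k m →ₛₗ[frob p (MvPolynomial (Fin m) k)
    (poly_natCast_eq_zero k m p)] MvLaurent k m where
  toFun l := l ^ p
  map_add' := add_pow_p p
  map_smul' s l := by
    rw [poly_smul_def, poly_smul_def, mul_pow, frob_apply, map_pow]

variable (k m) in
/-- The Frobenius action on the top local cohomology. -/
noncomputable def frobTop : Top k m →ₛₗ[frob p (MvPolynomial (Fin m) k)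
    (poly_natCast_eq_zero k m p)] Top k m :=
  Submodule.mapQ _ _ (frobL k m p) fun l hl b hb => by
    change (l ^ p).coeff b = 0
    -- All exponents of `l ^ p` are of the form p a, and p a is all-negative only if `a` is.
    by_cases h : ∃ a, p • a = b
    · obtain ⟨a, rfl⟩ := h
      rw [coeff_pow, hl a, zero_pow (Fact.out : p.Prime).ne_zero]
      intro j
      have := hb j
      simp only [Pi.smul_apply, nsmul_eq_mul] at this
      exact neg_of_mul_neg_right this (by positivity)
    · exact coeff_pow_of_ne p l fun a ha => h ⟨a, ha⟩

theorem frobTop_mk (l : MvLaurent k m) :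
    frobTop k m p ((nonneg k m).mkQ l) = (nonneg k m).mkQ (l ^ p) := rfl

theorem frobTop_smul (s : MvPolynomial (Fin m) k) (η : Top k m) :
    frobTop k m p (s • η) = s ^ p • frobTop k m p η :=
  map_smulₛₗ (frobTop k m p) s η

end Frobenius

/-! ### Cartier operators -/

section Cartier

/-- The additive map of monoid algebras that reads off the coefficients at `h a` and
applies `θ` to them. -/
noncomputable def readCoeff {G : Type*} (θ : k →+ k) (h : G → G)
    (hh : Function.Injective h) : AddMonoidAlgebra k G →+ AddMonoidAlgebra k G where
  toFun t := .ofCoeff ((Finsupp.mapRange.addMonoidHom θ) (Finsupp.comapDomain.addMonoidHom hh t.coeff))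
  map_zero' := by ext; simp
  map_add' s t := by ext; simp

@[simp] theorem coeff_readCoeff {G : Type*} (θ : k →+ k) (h : G → G)
    (hh : Function.Injective h) (t : AddMonoidAlgebra k G) (a : G) :
    (readCoeff θ h hh t).coeff a = θ (t.coeff (h a)) := rfl

/-- Vectors of digits as exponent vectors. -/
noncomputable def digits (m p : ℕ) (c : Fin m → Fin p) : Fin m →₀ ℕ :=
  Finsupp.equivFunOnFinite.symm fun j => c j

@[simp] theorem digits_apply (c : Fin m → Fin p) (j : Fin m) : digits m p c j = c j := rfl

theorem digits_lt (c : Fin m → Fin p) (j : Fin m) : digits m p c j < p := (c j).2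

variable (p : ℕ) [Fact p.Prime]

theorem shift_injective (c : Fin m → ℤ) :
    Function.Injective fun a : Fin m → ℤ => p • a + c := fun a b h => by
  ext j
  have := congrFun h j
  simpa [(Fact.out : p.Prime).ne_zero] using this

theorem shiftPoly_injective (c : Fin m →₀ ℕ) :
    Function.Injective fun a : Fin m →₀ ℕ => p • a + c := fun a b h => by
  ext j
  have := DFunLike.congr_fun h j
  simpa [(Fact.out : p.Prime).ne_zero] using this

/-- The Cartier operator on Laurent polynomials. -/
noncomputable def cartierL (θ : k →+ k) (c : Fin m →₀ ℕ) : MvLaurent k m →+ MvLaurent k m :=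
  readCoeff θ _ (shift_injective p (expCast m c))

/-- The Cartier operator on polynomials: the coefficient of `x ^ u` in `cartier p θ c t` is `θ`
of the coefficient of `x ^ (p u + c)` in `t`. -/
noncomputable def cartier (θ : k →+ k) (c : Fin m →₀ ℕ) :
    MvPolynomial (Fin m) k →+ MvPolynomial (Fin m) k :=
  readCoeff θ _ (shiftPoly_injective p c)

theorem coeff_cartierL (θ : k →+ k) (c : Fin m →₀ ℕ) (l : MvLaurent k m) (a : Fin m → ℤ) :
    (cartierL p θ c l).coeff a = θ (l.coeff (p • a + expCast m c)) := rfl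

theorem coeff_cartier (θ : k →+ k) (c : Fin m →₀ ℕ) (t : MvPolynomial (Fin m) k) (u : Fin m →₀ ℕ) :
    (cartier p θ c t).coeff u = θ (t.coeff (p • u + c)) := rfl

/-- The bound on the digits enters through negative exponents: if a_j < 0 and c_j < p then p a_j +
c_j < 0, so the operator on Laurent polynomials creates no negative exponents from a polynomial. -/
theorem ofPoly_cartier (θ : k →+ k) {c : Fin m →₀ ℕ} (hc : ∀ j, c j < p)
    (t : MvPolynomial (Fin m) k) :
    ofPoly k m (cartier p θ c t) = cartierL p θ c (ofPoly k m t) := by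
  ext a
  rw [coeff_cartierL]
  by_cases h : ∀ j, 0 ≤ a j
  · obtain ⟨u, rfl⟩ := exists_expCast_eq h
    rw [coeff_ofPoly, ← map_nsmul, ← map_add, coeff_ofPoly, coeff_cartier]
  · push Not at h
    obtain ⟨j, hj⟩ := h
    rw [coeff_ofPoly_of_neg _ hj, coeff_ofPoly_of_neg (j := j), map_zero]
    have := hc j
    simp only [Pi.add_apply, nsmul_eq_mul, expCast_apply, Pi.mul_apply, Pi.natCast_apply]
    nlinarith

section CharP

variable [CharP k p]

theorem cartierL_pow_mul {θ : k →+ k} (hθ : ∀ s y, θ (s ^ p * y) = s * θ y) (c : Fin m →₀ ℕ)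
    (l l' : MvLaurent k m) : cartierL p θ c (l ^ p * l') = l * cartierL p θ c l' := by
  induction l using AddMonoidAlgebra.induction_linear with
  | zero => simp [zero_pow (Fact.out : p.Prime).ne_zero]
  | add l₁ l₂ h₁ h₂ => rw [add_pow_p, add_mul, map_add, h₁, h₂, add_mul]
  | single b r =>
    ext a
    rw [AddMonoidAlgebra.single_pow, coeff_cartierL, AddMonoidAlgebra.coeff_single_mul_apply, hθ,
      AddMonoidAlgebra.coeff_single_mul_apply, coeff_cartierL, smul_add, smul_neg, add_assoc]

theorem cartier_pow_mul {θ : k →+ k} (hθ : ∀ s y, θ (s ^ p * y) = s * θ y) {c : Fin m →₀ ℕ}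
    (hc : ∀ j, c j < p) (s t : MvPolynomial (Fin m) k) :
    cartier p θ c (s ^ p * t) = s * cartier p θ c t := by
  apply ofPoly_injective
  rw [ofPoly_cartier p θ hc, map_mul, map_pow, cartierL_pow_mul p hθ, map_mul, ofPoly_cartier p θ hc]

/-- If a polynomial `g` kills the Frobenius image of `η`, the Cartier operators carry `g` into
the annihilator of `η`. -/
theorem cartier_smul_eq_zero {θ : k →+ k} (hθ : ∀ s y, θ (s ^ p * y) = s * θ y) {c : Fin m →₀ ℕ}
    (hc : ∀ j, c j < p) {g : MvPolynomial (Fin m) k} {η : Top k m}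
    (h : g • frobTop k m p η = 0) : cartier p θ c g • η = 0 := by
  obtain ⟨l, rfl⟩ := (nonneg k m).mkQ_surjective η
  rw [frobTop_mk, ← map_smul] at h
  rw [← map_smul]
  rw [Submodule.mkQ_apply, Submodule.Quotient.mk_eq_zero, mem_nonneg] at h ⊢
  intro a ha
  -- The coefficient at `a` of the Cartier image of g, times l, is θ of the coefficient of g l^p at
  -- p a + c. That exponent is again all-negative because a_j ≤ -1 and c_j < p.
  rw [poly_smul_def, ofPoly_cartier p θ hc, mul_comm, ← cartierL_pow_mul p hθ, coeff_cartierL,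
    mul_comm, ← poly_smul_def, h, map_zero]
  intro j
  have h1 := ha j
  have h2 := hc j
  simp only [Pi.add_apply, nsmul_eq_mul, expCast_apply, Pi.mul_apply, Pi.natCast_apply]
  nlinarith

end CharP

theorem cartier_monomial (θ : k →+ k) {c : Fin m →₀ ℕ} (hc : ∀ j, c j < p) (v : Fin m →₀ ℕ)
    (r : k) (w : Fin m →₀ ℕ) (hw : ∀ j, w j = v j / p) :
    cartier p θ c (monomial v r) = if ∀ j, v j % p = c j then monomial w (θ r) else 0 := by
  ext u
  rw [coeff_cartier, coeff_monomial]
  have hp := (Fact.out : p.Prime).pos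
  have key : v = p • u + c ↔ (∀ j, v j % p = c j) ∧ w = u := by
    constructor
    · rintro rfl
      refine ⟨fun j => ?_, ?_⟩
      · simp [Nat.mod_eq_of_lt (hc j)]
      · ext j
        rw [hw]
        simp [Nat.mul_add_div hp, Nat.div_eq_of_lt (hc j)]
    · rintro ⟨h1, rfl⟩
      ext j
      simp [hw, ← h1 j, Nat.div_add_mod]
  by_cases h : v = p • u + c
  · rw [if_pos h, if_pos (key.1 h).1, coeff_monomial, if_pos (key.1 h).2]
  · rw [if_neg h, map_zero]
    split_ifs with h1
    · rw [coeff_monomial, if_neg fun h2 => h (key.2 ⟨h1, h2⟩)]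
    · rw [coeff_zero]

/-- The Cartier operators are coordinates with respect to the generators e_b x^c of the polynomial
ring over its p-th powers: on x^v only the digits c ≡ v mod p contribute, and the rest is the
expansion of the coefficient of x^v in k over k^p. -/
theorem sum_cartier [CharP k p] {ι : Type*} [Fintype ι] {e : ι → k} {θ : ι → k →+ k}
    (hθ : ∀ y, ∑ b, θ b y ^ p * e b = y) (t : MvPolynomial (Fin m) k) :
    ∑ b, ∑ c, cartier p (θ b) (digits m p c) t ^ p * monomial (digits m p c) (e b) = t := by
  have hp := (Fact.out : p.Prime).pos
  induction t using MvPolynomial.induction_on' with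
  | add s t hs ht =>
    conv_rhs => rw [← hs, ← ht]
    simp only [map_add, add_pow_of_prime_eq_zero p (poly_natCast_eq_zero k m p), add_mul,
      Finset.sum_add_distrib]
  | monomial v r =>
    let w : Fin m →₀ ℕ := Finsupp.equivFunOnFinite.symm fun j => v j / p
    let c₀ : Fin m → Fin p := fun j => ⟨v j % p, Nat.mod_lt _ hp⟩
    have hv : p • w + digits m p c₀ = v := by
      ext j
      simp [w, c₀, Nat.div_add_mod]
    have h : ∀ b, ∑ c, cartier p (θ b) (digits m p c) (monomial v r) ^ p *
        monomial (digits m p c) (e b) = monomial v (θ b r ^ p * e b) := by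
      intro b
      rw [Finset.sum_eq_single c₀]
      · rw [cartier_monomial p (θ b) (digits_lt c₀) v r w fun j => rfl,
          if_pos (show ∀ j, v j % p = digits m p c₀ j from fun j => rfl), monomial_pow, monomial_mul, hv]
      · intro c _ hc
        rw [cartier_monomial p (θ b) (digits_lt c) v r w fun j => rfl, if_neg,
          zero_pow hp.ne', zero_mul]
        intro h
        exact hc (funext fun j => Fin.ext (h j).symm)
      · simp
    simp only [h]
    rw [← map_sum, hθ]

/-- Truncated subtraction and division are harmless: a nonzero coefficient at u forces e = p deg u +
deg c. -/
theorem isHomogeneous_cartier (θ : k →+ k) (c : Fin m →₀ ℕ) {t : MvPolynomial (Fin m) k} {e : ℕ}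
    (ht : t.IsHomogeneous e) : (cartier p θ c t).IsHomogeneous ((e - c.degree) / p) := by
  intro u hu
  rw [coeff_cartier] at hu
  have h : t.coeff (p • u + c) ≠ 0 := fun h => hu (by rw [h, map_zero])
  have := ht h
  have hw : Finsupp.weight (1 : Fin m → ℕ) = Finsupp.degree := Finsupp.degree_eq_weight_one.symm
  rw [hw] at this ⊢
  rw [← this, map_add, map_nsmul, Nat.add_sub_cancel, smul_eq_mul,
    Nat.mul_div_cancel_left _ (Fact.out : p.Prime).pos]

end Cartier

end MvLaurent

/-- Coordinates of a finite extension of fields. -/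
theorem RingHom.Finite.exists_coordinates {K K' : Type*} [Field K] [Field K'] {φ : K →+* K'}
    (h : φ.Finite) : ∃ (N : ℕ) (e : Fin N → K') (θ : Fin N → K' →+ K),
      (∀ b s y, θ b (φ s * y) = s * θ b y) ∧ ∀ y, ∑ b, φ (θ b y) * e b = y := by
  let := φ.toAlgebra
  have : Module.Finite K K' := h
  let B := Module.finBasis K K'
  refine ⟨_, B, fun b => (B.coord b).toAddMonoidHom, fun b s y => ?_, fun y => ?_⟩
  · have : φ s * y = s • y := rfl
    simp [this]
  · exact B.sum_repr y

namespace Cech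

/-! ## The connecting homomorphism -/

theorem card_filter_erase_lt {m : ℕ} {σ : Finset (Fin m)} {j l : Fin m} (h : l < j) (hl : l ∈ σ) :
    ((σ.erase l).filter (· < j)).card + 1 = (σ.filter (· < j)).card := by
  rw [Finset.filter_erase, Finset.card_erase_add_one (Finset.mem_filter.2 ⟨hl, h⟩)]

theorem card_filter_erase_of_lt {m : ℕ} {σ : Finset (Fin m)} {j l : Fin m} (h : j < l) :
    ((σ.erase l).filter (· < j)).card = (σ.filter (· < j)).card := by
  rw [Finset.filter_erase, Finset.erase_eq_of_notMem]
  simp [h.le]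

/-- Removing the smaller of two indices moves the larger one down by one position, while removing
the larger leaves the position of the smaller unchanged. -/
theorem sign_swap {R : Type*} [CommRing R] {m : ℕ} {σ : Finset (Fin m)} {j l : Fin m} (hj : j ∈ σ)
    (hl : l ∈ σ) (h : j ≠ l) :
    (-1 : R) ^ (σ.filter (· < j)).card * (-1) ^ ((σ.erase j).filter (· < l)).card =
      -((-1) ^ (σ.filter (· < l)).card * (-1) ^ ((σ.erase l).filter (· < j)).card) := by
  rcases lt_or_gt_of_ne h with h | h
  · rw [← card_filter_erase_lt h hj, card_filter_erase_of_lt h]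
    ring
  · rw [← card_filter_erase_lt h hl, card_filter_erase_of_lt h]
    ring

/-! ### The Čech differential squares to zero -/

section Complex

variable {A : Type*} [CommRing A] {m : ℕ} (x : Fin m → A)

theorem res_res {σ τ υ : Finset (Fin m)} (h : σ ⊆ τ) (h' : τ ⊆ υ) (a : Loc x σ) :
    res x h' (res x h a) = res x (h.trans h') a := by
  have : (res x h').toRingHom.comp (res x h).toRingHom = (res x (h.trans h')).toRingHom := by
    refine IsLocalization.ringHom_ext (Submonoid.powers (∏ j ∈ σ, x j)) ?_
    ext a
    simp
  exact congrArg (fun f => f a) this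

/-- A cochain as a function on all subsets of `σ`, with values in the localization at `σ`. -/
noncomputable def extend {i : ℕ} (α : C x i) (σ ρ : Finset (Fin m)) : Loc x σ :=
  if h : ρ.card = i ∧ ρ ⊆ σ then res x h.2 (α ⟨ρ, h.1⟩) else 0

theorem d_apply_eq_sum (i : ℕ) (α : C x i) (σ : {σ : Finset (Fin m) // σ.card = i + 1}) :
    d x i α σ = ∑ j ∈ σ.1, (-1 : A) ^ (σ.1.filter (· < j)).card •
      extend x α σ.1 (σ.1.erase j) := by
  rw [d_apply, ← Finset.sum_coe_sort σ.1]
  refine Finset.sum_congr rfl fun j _ => ?_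
  rw [extend, dif_pos ⟨by rw [Finset.card_erase_of_mem j.2, σ.2]; rfl, Finset.erase_subset _ _⟩]

theorem res_extend {i : ℕ} (α : C x i) {σ τ ρ : Finset (Fin m)} (h : σ ⊆ τ) (hρ : ρ ⊆ σ) :
    res x h (extend x α σ ρ) = extend x α τ ρ := by
  by_cases hc : ρ.card = i
  · rw [extend, extend, dif_pos ⟨hc, hρ⟩, dif_pos ⟨hc, hρ.trans h⟩, res_res]
  · rw [extend, extend, dif_neg fun h => hc h.1, dif_neg fun h => hc h.1, map_zero]

theorem d_d (i : ℕ) (α : C x i) : d x (i + 1) (d x i α) = 0 := by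
  ext σ
  have key : ∀ j ∈ σ.1, extend x (d x i α) σ.1 (σ.1.erase j) =
      ∑ l ∈ σ.1.erase j, (-1 : A) ^ ((σ.1.erase j).filter (· < l)).card •
        extend x α σ.1 ((σ.1.erase j).erase l) := by
    intro j hj
    have hc : (σ.1.erase j).card = i + 1 := by
      rw [Finset.card_erase_of_mem hj, σ.2]
      rfl
    rw [extend, dif_pos ⟨hc, Finset.erase_subset _ _⟩, d_apply_eq_sum, map_sum]
    refine Finset.sum_congr rfl fun l _ => ?_
    rw [_root_.map_smul, res_extend x α _ (Finset.erase_subset _ _)]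
  rw [d_apply_eq_sum, Finset.sum_congr rfl fun j hj => by rw [key j hj, Finset.smul_sum],
    Finset.sum_sigma']
  -- The terms that remove j then l and l then j have opposite signs.
  refine Finset.sum_involution (fun a _ => ⟨a.2, a.1⟩) ?_ ?_ ?_ ?_
  · rintro ⟨j, l⟩ h
    simp only [Finset.mem_sigma, Finset.mem_erase] at h
    rw [smul_smul, smul_smul, sign_swap h.1 h.2.2 h.2.1.symm, neg_smul, Finset.erase_right_comm,
      neg_add_cancel]
  · rintro ⟨j, l⟩ h _ he
    simp only [Finset.mem_sigma, Finset.mem_erase] at h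
    simp only [Sigma.mk.injEq] at he
    exact h.2.1 he.1
  · rintro ⟨j, l⟩ h
    simp only [Finset.mem_sigma, Finset.mem_erase] at h ⊢
    exact ⟨h.2.2, h.2.1.symm, h.1⟩
  · intros
    rfl

end Complex

/-! ### Construction of the connecting map -/

section Connecting

variable {A A' : Type*} [CommRing A] [CommRing A'] {m : ℕ} {x : Fin m → A} {x' : Fin m → A'}

theorem cmap_mem_B (π : A →+* A') (hx : ∀ j, π (x j) = x' j) :
    ∀ (i : ℕ) {α : C x i}, α ∈ B x i → cmap π hx i α ∈ B x' i
  | 0, α, h => by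
    rw [B, Submodule.mem_bot] at h ⊢
    rw [h, map_zero]
  | i + 1, _, ⟨β, rfl⟩ => ⟨cmap π hx i β, d_cmap π hx i β⟩

/-- A presentation `A' = A / g` by a nonzerodivisor `g`, compatible with the sequences of
elements. -/
structure RegularQuotient (x : Fin m → A) (x' : Fin m → A') (π : A →+* A') (g : A) : Prop where
  map_x : ∀ j, π (x j) = x' j
  surjective : Function.Surjective π
  map_eq_zero : π g = 0
  exists_eq_mul : ∀ a, π a = 0 → ∃ b, a = g * b
  regular : ∀ a, g * a = 0 → a = 0

variable {π : A →+* A'} {g : A} (Q : RegularQuotient x x' π g)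

include Q

theorem RegularQuotient.smul_cancel {i : ℕ} {α β : C x i} (h : g • α = g • β) : α = β := by
  rw [← sub_eq_zero]
  refine cochain_smul_eq_zero Q.regular ?_
  rw [smul_sub, h, sub_self]

theorem RegularQuotient.cmap_smul_eq_zero (i : ℕ) (α : C x i) :
    cmap π Q.map_x i (g • α) = 0 := by
  rw [cmap_smul, Q.map_eq_zero, zero_smul]

/-- A lift of a cocycle of `A'` has a differential divisible by `g`. -/
theorem RegularQuotient.exists_d_eq {i : ℕ} {α : C x i} (h : cmap π Q.map_x i α ∈ Z x' i) :
    ∃ ξ : Z x (i + 1), d x i α = g • ξ.1 := by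
  have h1 : cmap π Q.map_x (i + 1) (d x i α) = 0 := by
    rw [← d_cmap]
    exact LinearMap.mem_ker.1 h
  obtain ⟨ξ, hξ⟩ := exists_smul_of_cmap_eq_zero π Q.map_x Q.exists_eq_mul h1
  -- From g dξ = d(dα) = 0 it follows that dξ = 0, as `g` is a nonzerodivisor on cochains.
  refine ⟨⟨ξ, LinearMap.mem_ker.2 (Q.smul_cancel ?_)⟩, hξ⟩
  rw [← _root_.map_smul, ← hξ, d_d, smul_zero]

/-- Injectivity of the connecting map where H^i of `A` vanishes: if ξ = dγ, then α - gγ is a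
cocycle, hence a coboundary, with the same image as α. -/
theorem RegularQuotient.mem_B_of_d_eq {i : ℕ} (hv : Z x i ≤ B x i) {α : C x i} {ξ : C x (i + 1)}
    (hα : d x i α = g • ξ) (hξ : ξ ∈ B x (i + 1)) : cmap π Q.map_x i α ∈ B x' i := by
  obtain ⟨γ, rfl⟩ := hξ
  have h1 : α - g • γ ∈ Z x i := by
    rw [LinearMap.mem_ker, map_sub, _root_.map_smul, hα, sub_self]
  have h2 := cmap_mem_B π Q.map_x i (hv h1)
  rwa [map_sub, Q.cmap_smul_eq_zero, sub_zero] at h2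

/-- In the long exact sequence H^i of `A'` lies between H^i and H^{i+1} of `A`. -/
theorem RegularQuotient.Z_le_B {i : ℕ} (hv : Z x i ≤ B x i) (hv' : Z x (i + 1) ≤ B x (i + 1)) :
    Z x' i ≤ B x' i := by
  intro α' hα'
  obtain ⟨α, rfl⟩ := cmap_surjective π Q.map_x Q.surjective i α'
  obtain ⟨ξ, hξ⟩ := Q.exists_d_eq hα'
  exact Q.mem_B_of_d_eq hv hξ (hv' ξ.2)

variable {E : Type*} [AddCommGroup E] {Φ : Z x (i + 1) →+ E}

/-- The value is quantified outermost so that it can be chosen as a function of α', with the lift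
and the cocycle kept as witnesses. -/
theorem RegularQuotient.exists_conn (Φ : Z x (i + 1) →+ E) (α' : Z x' i) :
    ∃ e : E, ∃ (α : C x i) (ξ : Z x (i + 1)),
      cmap π Q.map_x i α = α'.1 ∧ d x i α = g • ξ.1 ∧ Φ ξ = e := by
  obtain ⟨α, hα⟩ := cmap_surjective π Q.map_x Q.surjective i α'.1
  obtain ⟨ξ, hξ⟩ := Q.exists_d_eq (hα ▸ α'.2)
  exact ⟨Φ ξ, α, ξ, hα, hξ, rfl⟩

/-- Independence of the lift: a lift of zero is gβ, so its ξ is the coboundary dβ. -/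
theorem RegularQuotient.eq_zero_of_cmap_eq_zero (hΦ : ∀ ξ, ξ.1 ∈ B x (i + 1) → Φ ξ = 0)
    {α : C x i} {ξ : Z x (i + 1)} (hα : cmap π Q.map_x i α = 0) (hξ : d x i α = g • ξ.1) :
    Φ ξ = 0 := by
  obtain ⟨β, rfl⟩ := exists_smul_of_cmap_eq_zero π Q.map_x Q.exists_eq_mul hα
  refine hΦ ξ ⟨β, Q.smul_cancel ?_⟩
  rw [← hξ, _root_.map_smul]

theorem RegularQuotient.eq_of_cmap_eq (hΦ : ∀ ξ, ξ.1 ∈ B x (i + 1) → Φ ξ = 0)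
    {α β : C x i} {ξ υ : Z x (i + 1)} (h : cmap π Q.map_x i α = cmap π Q.map_x i β)
    (hξ : d x i α = g • ξ.1) (hυ : d x i β = g • υ.1) : Φ ξ = Φ υ := by
  rw [← sub_eq_zero, ← map_sub]
  refine Q.eq_zero_of_cmap_eq_zero hΦ (α := α - β) ?_ ?_
  · rw [map_sub, h, sub_self]
  · rw [map_sub, hξ, hυ, ← smul_sub]
    rfl

/-- The connecting homomorphism, followed by a homomorphism that kills coboundaries. -/
noncomputable def RegularQuotient.conn (hΦ : ∀ ξ, ξ.1 ∈ B x (i + 1) → Φ ξ = 0) : Z x' i →+ E :=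
  AddMonoidHom.mk' (fun α' => (Q.exists_conn Φ α').choose) fun α' β' => by
    obtain ⟨α, ξ, hα, hξ, h⟩ := (Q.exists_conn Φ α').choose_spec
    obtain ⟨β, υ, hβ, hυ, h'⟩ := (Q.exists_conn Φ β').choose_spec
    obtain ⟨γ, ζ, hγ, hζ, h''⟩ := (Q.exists_conn Φ (α' + β')).choose_spec
    rw [← h, ← h', ← h'', ← map_add]
    refine Q.eq_of_cmap_eq hΦ (α := γ) (β := α + β) ?_ hζ ?_
    · rw [map_add, hα, hβ, hγ]
      rfl
    · rw [map_add, hξ, hυ, ← smul_add]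
      rfl

theorem RegularQuotient.conn_eq (hΦ : ∀ ξ, ξ.1 ∈ B x (i + 1) → Φ ξ = 0) {α' : Z x' i}
    {α : C x i} {ξ : Z x (i + 1)} (hα : cmap π Q.map_x i α = α'.1) (hξ : d x i α = g • ξ.1) :
    Q.conn hΦ α' = Φ ξ := by
  obtain ⟨β, υ, hβ, hυ, h⟩ := (Q.exists_conn Φ α').choose_spec
  refine h.symm.trans (Q.eq_of_cmap_eq hΦ (hβ.trans hα.symm) hυ hξ)

theorem RegularQuotient.conn_eq_zero_iff (hΦ : ∀ ξ, Φ ξ = 0 ↔ ξ.1 ∈ B x (i + 1))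
    (hv : Z x i ≤ B x i) (α' : Z x' i) :
    Q.conn (fun ξ => (hΦ ξ).2) α' = 0 ↔ α'.1 ∈ B x' i := by
  obtain ⟨_, α, ξ, hα, hξ, -⟩ := Q.exists_conn Φ α'
  constructor
  · rw [Q.conn_eq _ hα hξ, hΦ, ← hα]
    exact Q.mem_B_of_d_eq hv hξ
  · intro h
    cases i with
    | zero =>
      rw [B, Submodule.mem_bot] at h
      have : α' = 0 := Subtype.ext h
      rw [this, map_zero]
    | succ i =>
      obtain ⟨β', hβ'⟩ := h
      obtain ⟨β, rfl⟩ := cmap_surjective π Q.map_x Q.surjective i β'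
      -- A coboundary lifts to the coboundary `d x i β`, whose own differential is zero, so ξ = 0
      -- may be taken.
      rw [Q.conn_eq (α := d x i β) (ξ := 0) _ (by rw [← d_cmap, hβ']) (by simp [d_d]), map_zero]

end Connecting

end Cech

namespace Cech

/-! ### The connecting map, multiplication, Frobenius and degrees -/

section Connecting

theorem mem_ZDeg {A : Type*} [CommRing A] {m : ℕ} {x : Fin m → A} {𝒜 : ℕ → AddSubgroup A} {i : ℕ}
    {t : ℤ} {α : Z x i} : α ∈ ZDeg x 𝒜 i t ↔ α.1 ∈ CDeg x 𝒜 i t := Iff.rfl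

variable {A A' : Type*} [CommRing A] [CommRing A'] {m : ℕ} {x : Fin m → A} {x' : Fin m → A'}

theorem cmap_mem_CDeg {𝒜 : ℕ → AddSubgroup A} {𝒜' : ℕ → AddSubgroup A'} (π : A →+* A')
    (hx : ∀ j, π (x j) = x' j) (hπ : ∀ e, ∀ a ∈ 𝒜 e, π a ∈ 𝒜' e) {i : ℕ} {t : ℤ} {α : C x i}
    (hα : α ∈ CDeg x 𝒜 i t) : cmap π hx i α ∈ CDeg x' 𝒜' i t := by
  refine mem_CDeg.2 fun σ => ?_
  rw [cmap_apply]
  have ha := mem_CDeg.1 hα σ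
  generalize α σ = a at ha
  induction ha using AddSubgroup.closure_induction with
  | zero => rw [map_zero]; exact zero_mem _
  | add a b _ _ ha hb => rw [map_add]; exact add_mem ha hb
  | neg a _ ha => rw [map_neg]; exact neg_mem ha
  | mem a ha =>
    obtain ⟨N, e, g, hg, he, hag⟩ := ha
    refine AddSubgroup.subset_closure ⟨N, e, π g, hπ e g hg, he, ?_⟩
    rw [← locMap_prod π hx, ← map_pow, ← map_mul, hag, locMap_algebraMap]

variable {π : A →+* A'} {g : A} (Q : RegularQuotient x x' π g) {E : Type*} [AddCommGroup E]
  {i : ℕ} {Φ : Z x (i + 1) →+ E} (hΦ : ∀ ξ, ξ.1 ∈ B x (i + 1) → Φ ξ = 0)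

/-- Since `E` is only an additive group, the action of `r` on it is supplied as a map `u`. -/
theorem RegularQuotient.conn_smul {r : A} {u : E → E} (hu : ∀ ξ, Φ (r • ξ) = u (Φ ξ))
    (α' : Z x' i) : Q.conn hΦ (π r • α') = u (Q.conn hΦ α') := by
  obtain ⟨_, α, ξ, hα, hξ, -⟩ := Q.exists_conn Φ α'
  rw [Q.conn_eq hΦ hα hξ, ← hu]
  refine Q.conn_eq hΦ (α := r • α) ?_ ?_
  · rw [cmap_smul, hα]
    rfl
  · rw [_root_.map_smul, hξ, smul_comm]
    rfl

/-- This is the source of the twist: if dα = gξ, then the p-th power of α has differential g^p ξ^p =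
g · (g^{p-1} ξ^p). -/
theorem RegularQuotient.conn_frobZ {p : ℕ} [Fact p.Prime] (hp : (p : A) = 0) (hp' : (p : A') = 0)
    {u F : E → E} (hu : ∀ ξ, Φ (g ^ (p - 1) • ξ) = u (Φ ξ))
    (hF : ∀ ξ, Φ (frobZ x p hp (i + 1) ξ) = F (Φ ξ)) (α' : Z x' i) :
    Q.conn hΦ (frobZ x' p hp' i α') = u (F (Q.conn hΦ α')) := by
  obtain ⟨_, α, ξ, hα, hξ, -⟩ := Q.exists_conn Φ α'
  have h1 : p - 1 + 1 = p := Nat.sub_add_cancel (Fact.out : p.Prime).one_le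
  rw [Q.conn_eq hΦ hα hξ, ← hF, ← hu]
  refine Q.conn_eq hΦ (α := frobC x p hp i α) ?_ ?_
  · rw [cmap_frobC π Q.map_x p hp hp', hα]
    rfl
  · rw [d_frobC, hξ, map_smulₛₗ, frob_apply]
    change _ = g • (g ^ (p - 1) • frobC x p hp (i + 1) ξ.1)
    rw [smul_smul, ← pow_succ', h1]

variable {𝒜 : ℕ → AddSubgroup A} {𝒜' : ℕ → AddSubgroup A'} [SetLike.GradedMonoid 𝒜]
  (ρ : Coaction x 𝒜) {δ : ℕ}

include ρ in
theorem RegularQuotient.exists_conn_eq_of_mem_ZDeg (hg : g ∈ 𝒜 δ)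
    (hlift : ∀ e, ∀ a' ∈ 𝒜' e, ∃ a ∈ 𝒜 e, π a = a') {t : ℤ} {α' : Z x' i}
    (hα' : α' ∈ ZDeg x' 𝒜' i t) : ∃ ξ ∈ ZDeg x 𝒜 (i + 1) (t - δ), Q.conn hΦ α' = Φ ξ := by
  obtain ⟨α, hαt, hα⟩ := exists_cmap_eq_of_mem_CDeg π Q.map_x hlift (mem_ZDeg.1 hα')
  obtain ⟨ξ, hξ⟩ := Q.exists_d_eq (hα ▸ α'.2)
  -- The lift has degree t, so gξ has degree t; cancelling the nonzerodivisor `g` puts ξ in degree t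
  -- - δ.
  refine ⟨ξ, mem_ZDeg.2 (ρ.mem_of_smul_mem hg Q.regular ?_), Q.conn_eq hΦ hα hξ⟩
  rw [sub_add_cancel, ← hξ]
  exact ρ.d_mem i hαt

include ρ in
-- The image of the connecting map consists of the classes killed by `g`. A cochain with
-- differential gξ may be replaced by its component of degree t, because projection commutes with
-- the differential.
theorem RegularQuotient.exists_conn_eq (hg : g ∈ 𝒜 δ) (hπ : ∀ e, ∀ a ∈ 𝒜 e, π a ∈ 𝒜' e) {t : ℤ}
    {ξ : Z x (i + 1)} (hξ : ξ ∈ ZDeg x 𝒜 (i + 1) (t - δ)) (hgξ : g • ξ.1 ∈ B x (i + 1)) :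
    ∃ α' ∈ ZDeg x' 𝒜' i t, Q.conn hΦ α' = Φ ξ := by
  obtain ⟨α, hα⟩ := hgξ
  have hgt : g • ξ.1 ∈ CDeg x 𝒜 (i + 1) t := by
    refine mem_CDeg.2 fun σ => ?_
    have := smul_mem_locDeg hg (mem_CDeg.1 hξ σ)
    rwa [sub_add_cancel] at this
  have hα' : d x i (ρ.cproj i t α) = g • ξ.1 := by
    rw [ρ.d_cproj, hα, ρ.cproj_self hgt]
  refine ⟨⟨cmap π Q.map_x i (ρ.cproj i t α), ?_⟩, ?_, Q.conn_eq hΦ rfl hα'⟩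
  · rw [LinearMap.mem_ker, d_cmap, hα', Q.cmap_smul_eq_zero]
  · exact cmap_mem_CDeg π Q.map_x hπ (ρ.cproj_mem i t α)

end Connecting

end Cech

/-! ## Quotients by homogeneous ideals -/

/-- An ideal generated by forms. -/
def Ideal.GeneratedByForms {k : Type*} [Field k] {m : ℕ} (J : Ideal (MvPolynomial (Fin m) k)) :
    Prop :=
  ∃ G : Set (MvPolynomial (Fin m) k), (∀ g ∈ G, ∃ e, g.IsHomogeneous e) ∧ Ideal.span G = J

namespace Ideal.GeneratedByForms

variable {k : Type*} [Field k] {m : ℕ}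

theorem sup {J J' : Ideal (MvPolynomial (Fin m) k)} (h : J.GeneratedByForms)
    (h' : J'.GeneratedByForms) : (J ⊔ J').GeneratedByForms := by
  obtain ⟨G, hG, rfl⟩ := h
  obtain ⟨G', hG', rfl⟩ := h'
  exact ⟨G ∪ G', fun g hg => hg.elim (hG g) (hG' g), Ideal.span_union _ _⟩

theorem sup_span_singleton {J : Ideal (MvPolynomial (Fin m) k)} (h : J.GeneratedByForms)
    {g : MvPolynomial (Fin m) k} {e : ℕ} (hg : g.IsHomogeneous e) :
    (J ⊔ Ideal.span {g}).GeneratedByForms :=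
  h.sup ⟨{g}, fun _ hg' => ⟨e, hg' ▸ hg⟩, rfl⟩

end Ideal.GeneratedByForms

namespace MvLaurent

variable {k : Type*} [Field k] {n : ℕ}

/-- The residue classes of the variables. -/
noncomputable abbrev quotX (J : Ideal (MvPolynomial (Fin (n + 1)) k)) :
    Fin (n + 1) → MvPolynomial (Fin (n + 1)) k ⧸ J := fun j => Ideal.Quotient.mk J (X j)

theorem prod_single {B ι : Type*} [CommRing B] (s : Finset ι) (a : ι → ℤ) (b : ι → B) :
    ∏ j ∈ s, AddMonoidAlgebra.single (a j) (b j) =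
      AddMonoidAlgebra.single (∑ j ∈ s, a j) (∏ j ∈ s, b j) := by
  classical
  induction s using Finset.induction_on with
  | empty => rfl
  | insert j s hj ih => rw [Finset.prod_insert hj, ih, AddMonoidAlgebra.single_mul_single,
      Finset.sum_insert hj, Finset.prod_insert hj]

/-- The homomorphism `g ↦ g T ^ e` for forms `g` of degree `e`. -/
noncomputable def polyCoaction (J : Ideal (MvPolynomial (Fin (n + 1)) k)) :
    MvPolynomial (Fin (n + 1)) k →+* AddMonoidAlgebra (MvPolynomial (Fin (n + 1)) k ⧸ J) ℤ :=
  MvPolynomial.eval₂Hom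
    (AddMonoidAlgebra.singleZeroRingHom.comp ((Ideal.Quotient.mk J).comp MvPolynomial.C))
    fun j => AddMonoidAlgebra.single (1 : ℤ) (quotX J j)

theorem polyCoaction_of_isHomogeneous (J : Ideal (MvPolynomial (Fin (n + 1)) k)) {e : ℕ}
    {s : MvPolynomial (Fin (n + 1)) k} (hs : s.IsHomogeneous e) :
    polyCoaction J s = AddMonoidAlgebra.single (e : ℤ) (Ideal.Quotient.mk J s) := by
  have hmon : ∀ (u : Fin (n + 1) →₀ ℕ) (r : k), polyCoaction J (monomial u r) =
      AddMonoidAlgebra.single (u.degree : ℤ) (Ideal.Quotient.mk J (monomial u r)) := by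
    intro u r
    rw [polyCoaction, coe_eval₂Hom, eval₂_monomial, Finsupp.prod_fintype _ _ (by simp)]
    simp only [AddMonoidAlgebra.single_pow, prod_single]
    change AddMonoidAlgebra.single 0 (Ideal.Quotient.mk J (C r)) * _ = _
    rw [AddMonoidAlgebra.single_mul_single, monomial_eq, map_mul, map_finsuppProd,
      Finsupp.prod_fintype _ _ (by simp), Finsupp.degree_eq_sum]
    simp [-LaurentPolynomial.single_eq_C_mul_T]
  rw [s.as_sum, map_sum, map_sum, ← AddMonoidAlgebra.singleAddHom_apply, map_sum]
  refine Finset.sum_congr rfl fun u hu => ?_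
  have : u.degree = e := by
    have := hs (mem_support_iff.1 hu)
    rwa [show Finsupp.weight (1 : Fin (n + 1) → ℕ) = Finsupp.degree from
      Finsupp.degree_eq_weight_one.symm] at this
  rw [hmon, this, AddMonoidAlgebra.singleAddHom_apply]

/-- The coaction on the quotient by an ideal generated by forms. -/
noncomputable def coaction {J : Ideal (MvPolynomial (Fin (n + 1)) k)} (hJ : J.GeneratedByForms) :
    Cech.Coaction (quotX J) (quotDeg J) where
  toHom := Ideal.Quotient.lift J (polyCoaction J) (by
    obtain ⟨G, hG, hGJ⟩ := hJ
    have : J ≤ RingHom.ker (polyCoaction J) := by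
      conv_lhs => rw [← hGJ]
      refine Ideal.span_le.2 fun g hg => ?_
      obtain ⟨e, he⟩ := hG g hg
      have hgJ : g ∈ J := hGJ ▸ Ideal.subset_span hg
      change polyCoaction J g = 0
      rw [polyCoaction_of_isHomogeneous J he, Ideal.Quotient.eq_zero_iff_mem.2 hgJ]
      exact AddMonoidAlgebra.single_zero _
    exact fun a ha => this ha)
  apply_of_mem := by
    rintro e _ ⟨s, hs, rfl⟩
    exact polyCoaction_of_isHomogeneous J hs
  iSup_eq_top := by
    refine (AddSubgroup.eq_top_iff' _).2 fun a => ?_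
    obtain ⟨s, rfl⟩ := Ideal.Quotient.mk_surjective a
    rw [← sum_homogeneousComponent s, map_sum]
    exact sum_mem fun e _ => AddSubgroup.mem_iSup_of_mem e
      ⟨_, homogeneousComponent_mem e s, rfl⟩
  mem_one j := ⟨X j, isHomogeneous_X k j, rfl⟩

/-- The quotient map `S / J → S / (J + g)`. -/
theorem regularQuotient_factor {J J' : Ideal (MvPolynomial (Fin (n + 1)) k)} (h : J ≤ J')
    {g : MvPolynomial (Fin (n + 1)) k} (hJ' : J' = J ⊔ Ideal.span {g})
    (hg : ∀ s, g * s ∈ J → s ∈ J) :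
    Cech.RegularQuotient (quotX J) (quotX J') (Ideal.Quotient.factor h)
      (Ideal.Quotient.mk J g) where
  map_x _ := rfl
  surjective := Ideal.Quotient.factor_surjective _
  map_eq_zero := by
    rw [Ideal.Quotient.factor_mk, Ideal.Quotient.eq_zero_iff_mem, hJ']
    exact Ideal.mem_sup_right (Ideal.mem_span_singleton_self g)
  exists_eq_mul a ha := by
    obtain ⟨s, rfl⟩ := Ideal.Quotient.mk_surjective a
    rw [Ideal.Quotient.factor_mk, Ideal.Quotient.eq_zero_iff_mem, hJ'] at ha
    obtain ⟨u, hu, v, hv, rfl⟩ := Submodule.mem_sup.1 ha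
    obtain ⟨w, rfl⟩ := Ideal.mem_span_singleton'.1 hv
    refine ⟨Ideal.Quotient.mk J w, ?_⟩
    rw [map_add, Ideal.Quotient.eq_zero_iff_mem.2 hu, zero_add, map_mul, mul_comm]
  regular a ha := by
    obtain ⟨s, rfl⟩ := Ideal.Quotient.mk_surjective a
    rw [← map_mul, Ideal.Quotient.eq_zero_iff_mem] at ha
    exact Ideal.Quotient.eq_zero_iff_mem.2 (hg s ha)

variable (p : ℕ) [Fact p.Prime] [CharP k p]

/-- The local cohomology of `S / J` vanishes below degree `i`, and `Φ` identifies `H^i` with the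
annihilator of `J` in `H^{n+1}` of `S`, with degrees shifted by `d`; the Frobenius of `H^i`
corresponds to `q ^ (p - 1)` times the Frobenius. -/
structure DualityMap (J : Ideal (MvPolynomial (Fin (n + 1)) k)) (i : ℕ) (d : ℤ)
    (q : MvPolynomial (Fin (n + 1)) k) where
  Z_le_B : ∀ i' < i, Cech.Z (quotX J) i' ≤ Cech.B (quotX J) i'
  Φ : Cech.Z (quotX J) i →+ Top k (n + 1)
  eq_zero_iff : ∀ α, Φ α = 0 ↔ α.1 ∈ Cech.B (quotX J) i
  map_smul : ∀ s α, Φ (Ideal.Quotient.mk J s • α) = s • Φ α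
  map_frob : ∀ α, Φ (Cech.frobZ _ p (quot_natCast_eq_zero p J) i α) =
    q ^ (p - 1) • frobTop k (n + 1) p (Φ α)
  map_deg : ∀ t, ∀ α ∈ Cech.ZDeg (quotX J) (quotDeg J) i t, Φ α ∈ topDeg k (n + 1) (t - d)
  exists_eq : ∀ t, ∀ η ∈ topDeg k (n + 1) (t - d), (∀ s ∈ J, s • η = 0) →
    ∃ α ∈ Cech.ZDeg (quotX J) (quotDeg J) i t, Φ α = η

variable {p}

theorem exists_quotDeg_factor {J J' : Ideal (MvPolynomial (Fin (n + 1)) k)} (h : J ≤ J') (e : ℕ)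
    {a' : MvPolynomial (Fin (n + 1)) k ⧸ J'} (ha' : a' ∈ quotDeg J' e) :
    ∃ a ∈ quotDeg J e, Ideal.Quotient.factor h a = a' := by
  obtain ⟨s, hs, rfl⟩ := ha'
  exact ⟨Ideal.Quotient.mk J s, ⟨s, hs, rfl⟩, rfl⟩

/-- Passage to the quotient by a regular form. -/
theorem DualityMap.quotient_of_eq {J J' : Ideal (MvPolynomial (Fin (n + 1)) k)}
    (hJ : J.GeneratedByForms) {i : ℕ} {d : ℤ} {q : MvPolynomial (Fin (n + 1)) k}
    (D : DualityMap p J (i + 1) d q) {g : MvPolynomial (Fin (n + 1)) k} {δ : ℕ}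
    (hδ : g.IsHomogeneous δ) (hg : ∀ s, g * s ∈ J → s ∈ J)
    (h : J ≤ J') (hJ' : J' = J ⊔ Ideal.span {g}) :
    Nonempty (DualityMap p J' i (d + δ) (g * q)) := by
  have Q := regularQuotient_factor h hJ' hg
  have hgδ : Ideal.Quotient.mk J g ∈ quotDeg J δ := ⟨g, hδ, rfl⟩
  have hΦ := fun ξ => (D.eq_zero_iff ξ).2
  have hg0 : g ∈ J' := hJ' ▸ Ideal.mem_sup_right (Ideal.mem_span_singleton_self g)
  have h1 : ∀ s α', Q.conn hΦ (Ideal.Quotient.mk J' s • α') =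
      s • Q.conn hΦ α' :=
    fun s α' => Q.conn_smul (u := fun η => s • η) hΦ (D.map_smul s) α'
  have h2 : ∀ α', Q.conn hΦ (Cech.frobZ _ p (quot_natCast_eq_zero p _) i α') =
      (g * q) ^ (p - 1) • frobTop k (n + 1) p (Q.conn hΦ α') := by
    intro α'
    rw [mul_pow, mul_smul]
    exact Q.conn_frobZ hΦ _ _ (u := fun η => g ^ (p - 1) • η)
      (F := fun η => q ^ (p - 1) • frobTop k (n + 1) p η)
      (fun ξ => by rw [← map_pow]; exact D.map_smul _ ξ) D.map_frob α'
  have h3 : ∀ t, ∀ α' ∈ Cech.ZDeg (quotX J') (quotDeg _) i t,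
      Q.conn hΦ α' ∈ topDeg k (n + 1) (t - (d + δ)) := by
    intro t α' hα'
    obtain ⟨ξ, hξ, hc⟩ := Q.exists_conn_eq_of_mem_ZDeg hΦ (coaction hJ) hgδ
      (fun e a' ha' => exists_quotDeg_factor _ e ha') hα'
    rw [hc, ← sub_sub, sub_right_comm]
    exact D.map_deg _ _ hξ
  have h4 : ∀ t, ∀ η ∈ topDeg k (n + 1) (t - (d + δ)), (∀ s ∈ J', s • η = 0) →
      ∃ α ∈ Cech.ZDeg (quotX J') (quotDeg _) i t, Q.conn hΦ α = η := by
    intro t η hη hJη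
    rw [← sub_sub, sub_right_comm] at hη
    obtain ⟨ξ, hξt, rfl⟩ := D.exists_eq (t - δ) η hη fun s hs => hJη s (h hs)
    refine Q.exists_conn_eq hΦ (coaction hJ) hgδ
      (fun e a ha => by obtain ⟨s, hs, rfl⟩ := ha; exact ⟨s, hs, rfl⟩) hξt ?_
    -- A class lies in the image of the connecting map once g times it is a coboundary, and this
    -- holds because g ∈ J' kills η.
    refine (D.eq_zero_iff (Ideal.Quotient.mk J g • ξ)).1 ?_
    rw [D.map_smul, hJη _ hg0]
  exact ⟨⟨fun i' hi' => Q.Z_le_B (D.Z_le_B i' (by omega)) (D.Z_le_B (i' + 1) (by omega)),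
    Q.conn hΦ, Q.conn_eq_zero_iff D.eq_zero_iff (D.Z_le_B i (by omega)), h1, h2, h3, h4⟩⟩

theorem DualityMap.quotient {J : Ideal (MvPolynomial (Fin (n + 1)) k)}
    (hJ : J.GeneratedByForms) {i : ℕ} {d : ℤ} {q : MvPolynomial (Fin (n + 1)) k}
    (D : DualityMap p J (i + 1) d q) {g : MvPolynomial (Fin (n + 1)) k} {δ : ℕ}
    (hδ : g.IsHomogeneous δ) (hg : ∀ s, g * s ∈ J → s ∈ J) :
    Nonempty (DualityMap p (J ⊔ Ideal.span {g}) i (d + δ) (g * q)) :=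
  D.quotient_of_eq hJ hδ hg le_sup_left rfl

end MvLaurent

namespace MvLaurent

/-! ## Local cohomology of the polynomial ring -/

section Localization

variable {k : Type*} [Field k] {m : ℕ}

theorem ofPoly_isHomogeneous_mem_deg {e : ℕ} {s : MvPolynomial (Fin m) k}
    (hs : s.IsHomogeneous e) : ofPoly k m s ∈ deg k m e := by
  intro a ha
  by_cases h : ∀ j, 0 ≤ a j
  · obtain ⟨u, rfl⟩ := exists_expCast_eq h
    rw [coeff_ofPoly]
    by_contra hu
    refine ha ?_
    have := hs hu
    rw [show Finsupp.weight (1 : Fin m → ℕ) = Finsupp.degree from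
      Finsupp.degree_eq_weight_one.symm] at this
    rw [sum_expCast, this]
  · push Not at h
    obtain ⟨j, hj⟩ := h
    exact coeff_ofPoly_of_neg s hj

/-- The characteristic vector of a set of variables. -/
def indicator (σ : Finset (Fin m)) : Fin m → ℤ := fun j => if j ∈ σ then 1 else 0

theorem sum_indicator (σ : Finset (Fin m)) : ∑ j, indicator σ j = σ.card := by
  simp [indicator]

theorem single_indicator (σ : Finset (Fin m)) :
    ∏ j ∈ σ, AddMonoidAlgebra.single (indicator {j}) (1 : k) =
      AddMonoidAlgebra.single (indicator σ) 1 := by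
  classical
  induction σ using Finset.induction_on with
  | empty => rfl
  | insert j s hj ih =>
    rw [Finset.prod_insert hj, ih, AddMonoidAlgebra.single_mul_single, one_mul]
    congr 1
    ext l
    by_cases hl : l = j
    · subst hl
      simp [indicator, hj]
    · simp [indicator, hl]

theorem ofPoly_X (j : Fin m) :
    ofPoly k m (X j) = AddMonoidAlgebra.single (indicator {j}) 1 := by
  rw [X, ofPoly_monomial]
  congr 1
  ext l
  simp [indicator, Finsupp.single_apply, eq_comm]

theorem sum_single (l : MvLaurent k m) :
    ∑ a ∈ l.coeff.support, AddMonoidAlgebra.single a (l.coeff a) = l := by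
  refine AddMonoidAlgebra.coeff_injective ?_
  rw [AddMonoidAlgebra.coeff_sum]
  simp only [AddMonoidAlgebra.coeff_single]
  exact Finsupp.sum_single l.coeff

/-- A ring of polynomials inside of the Laurent polynomials. -/
structure PolyModel {A : Type*} [CommRing A] (x : Fin m → A) (𝒜 : ℕ → AddSubgroup A)
    (ι : A →+* MvLaurent k m) : Prop where
  injective : Function.Injective ι
  map_x : ∀ j, ι (x j) = AddMonoidAlgebra.single (indicator {j}) 1
  coeff_eq_zero : ∀ s (a : Fin m → ℤ) j, a j < 0 → (ι s).coeff a = 0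
  mem_deg : ∀ e, ∀ s ∈ 𝒜 e, ι s ∈ deg k m e
  exists_eq : ∀ u r, ∃ s ∈ 𝒜 u.degree, ι s = AddMonoidAlgebra.single (expCast m u) r

variable {A : Type*} [CommRing A] {x : Fin m → A} {𝒜 : ℕ → AddSubgroup A}
  {ι : A →+* MvLaurent k m} (M : PolyModel x 𝒜 ι)

namespace PolyModel

include M

theorem map_prod (σ : Finset (Fin m)) :
    ι (∏ j ∈ σ, x j) = AddMonoidAlgebra.single (indicator σ) 1 := by
  rw [_root_.map_prod, ← single_indicator]
  exact Finset.prod_congr rfl fun j _ => M.map_x j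

/-- The localizations as rings of Laurent polynomials. -/
noncomputable def ofLoc (σ : Finset (Fin m)) : Cech.Loc x σ →+* MvLaurent k m :=
  IsLocalization.Away.lift (∏ j ∈ σ, x j) (g := ι) (by
    rw [M.map_prod]
    refine IsUnit.of_mul_eq_one (AddMonoidAlgebra.single (-indicator σ) 1) ?_
    rw [AddMonoidAlgebra.single_mul_single, one_mul, add_neg_cancel]
    rfl)

theorem ofLoc_algebraMap (σ : Finset (Fin m)) (a : A) :
    M.ofLoc σ (algebraMap _ (Cech.Loc x σ) a) = ι a :=
  IsLocalization.Away.lift_eq _ _ a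

theorem ofLoc_smul (σ : Finset (Fin m)) (a : A) (b : Cech.Loc x σ) :
    M.ofLoc σ (a • b) = ι a * M.ofLoc σ b := by
  rw [Algebra.smul_def, map_mul, ofLoc_algebraMap]

theorem ofLoc_res {σ τ : Finset (Fin m)} (h : σ ⊆ τ) (b : Cech.Loc x σ) :
    M.ofLoc τ (Cech.res _ h b) = M.ofLoc σ b := by
  have : (M.ofLoc τ).comp (Cech.res _ h).toRingHom = M.ofLoc σ := by
    refine IsLocalization.ringHom_ext (Submonoid.powers (∏ j ∈ σ, x j)) ?_
    refine RingHom.ext fun a => ?_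
    simp [ofLoc_algebraMap]
  exact congrArg (fun f => f b) this

theorem coeff_ofLoc_of_mul_eq {σ : Finset (Fin m)} {b : Cech.Loc x σ} {N : ℕ} {s : A}
    (h : b * algebraMap _ (Cech.Loc x σ) (∏ j ∈ σ, x j) ^ N = algebraMap _ _ s)
    (a : Fin m → ℤ) : (M.ofLoc σ b).coeff a = (ι s).coeff (a + N • indicator σ) := by
  rw [← M.ofLoc_algebraMap σ, ← h, map_mul, map_pow, ofLoc_algebraMap, M.map_prod,
    AddMonoidAlgebra.single_pow, mul_comm, AddMonoidAlgebra.coeff_single_mul_apply]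
  simp

theorem ofLoc_injective (σ : Finset (Fin m)) :
    Function.Injective (M.ofLoc σ) := by
  refine (injective_iff_map_eq_zero _).2 fun b hb => ?_
  obtain ⟨N, s, h⟩ := IsLocalization.Away.surj (∏ j ∈ σ, x j) b
  refine Cech.mul_prod_pow_cancel x (N := N) ?_
  have h1 : ι s = 0 := by rw [← M.ofLoc_algebraMap σ, ← h, map_mul, hb, zero_mul]
  rw [h, M.injective (h1.trans (map_zero _).symm), map_zero, zero_mul]

/-- Together with `exists_ofLoc_eq` this describes the localization at σ: the Laurent polynomials
whose exponents are nonnegative outside σ. -/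
theorem coeff_ofLoc_eq_zero {σ : Finset (Fin m)} (b : Cech.Loc x σ) {a : Fin m → ℤ}
    {j : Fin m} (hj : j ∉ σ) (ha : a j < 0) : (M.ofLoc σ b).coeff a = 0 := by
  obtain ⟨N, s, h⟩ := IsLocalization.Away.surj (∏ j ∈ σ, x j) b
  rw [M.coeff_ofLoc_of_mul_eq h]
  refine M.coeff_eq_zero s _ j ?_
  simpa [indicator, hj] using ha

theorem ofLoc_mem_deg {σ : Finset (Fin m)} {t : ℤ} {b : Cech.Loc x σ}
    (hb : b ∈ Cech.locDeg x 𝒜 σ t) : M.ofLoc σ b ∈ deg k m t := by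
  induction hb using AddSubgroup.closure_induction with
  | zero => rw [map_zero]; exact zero_mem _
  | add a b _ _ ha hb => rw [map_add]; exact add_mem ha hb
  | neg a _ ha => rw [map_neg]; exact neg_mem ha
  | mem b hb =>
    obtain ⟨N, e, s, hs, he, h⟩ := hb
    intro a ha
    rw [M.coeff_ofLoc_of_mul_eq h]
    refine M.mem_deg e s hs _ fun h' => ha ?_
    have h1 : ∑ j, (a + N • indicator σ) j = ∑ j, a j + N * σ.card := by
      rw [← sum_indicator σ, Finset.mul_sum, ← Finset.sum_add_distrib]
      simp
    linarith

theorem exists_ofLoc_eq_single (σ : Finset (Fin m)) (a : Fin m → ℤ) (r : k)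
    (ha : ∀ j ∉ σ, 0 ≤ a j) : ∃ b ∈ Cech.locDeg x 𝒜 σ (∑ j, a j),
      M.ofLoc σ b = AddMonoidAlgebra.single a r := by
  -- Large enough that multiplication by the `N`-th power of the product over σ clears all negative
  -- exponents.
  let N : ℕ := ∑ j, (a j).natAbs
  have hN : ∀ j, 0 ≤ (a + N • indicator σ) j := by
    intro j
    by_cases hj : j ∈ σ
    · have : (a j).natAbs ≤ N :=
        Finset.single_le_sum (f := fun j => (a j).natAbs) (fun _ _ => Nat.zero_le _)
          (Finset.mem_univ j)
      simp [indicator, hj]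
      omega
    · simpa [indicator, hj] using ha j hj
  obtain ⟨u, hu⟩ := exists_expCast_eq hN
  obtain ⟨v, hv⟩ := Cech.exists_mul_inverse_pow x σ N
  obtain ⟨s, hmem, hs⟩ := M.exists_eq u r
  have h1 := Cech.algebraMap_mul_inverse_mem_locDeg hmem hv
  have h2 : (u.degree : ℤ) - N * σ.card = ∑ j, a j := by
    rw [← sum_expCast, hu, ← sum_indicator σ, Finset.mul_sum, ← Finset.sum_sub_distrib]
    simp
  rw [h2] at h1
  refine ⟨_, h1, ?_⟩
  ext b
  rw [M.coeff_ofLoc_of_mul_eq (N := N) (s := s)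
    (by rw [mul_assoc, mul_comm v, hv, mul_one]), hs, hu,
    AddMonoidAlgebra.coeff_single, AddMonoidAlgebra.coeff_single, Finsupp.single_apply,
    Finsupp.single_apply]
  simp only [add_left_inj]

theorem exists_ofLoc_eq (σ : Finset (Fin m)) (l : MvLaurent k m)
    (hl : ∀ a, l.coeff a ≠ 0 → ∀ j ∉ σ, 0 ≤ a j) : ∃ b, M.ofLoc σ b = l := by
  choose! b _ hb using fun a (h : l.coeff a ≠ 0) =>
    M.exists_ofLoc_eq_single σ a (l.coeff a) (hl a h)
  refine ⟨∑ a ∈ l.coeff.support, b a, ?_⟩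
  conv_rhs => rw [← sum_single l]
  rw [map_sum]
  exact Finset.sum_congr rfl fun a ha => hb a (Finsupp.mem_support_iff.1 ha)

theorem exists_ofLoc_eq_of_mem_deg (σ : Finset (Fin m)) {t : ℤ} {l : MvLaurent k m}
    (hl : ∀ a, l.coeff a ≠ 0 → ∀ j ∉ σ, 0 ≤ a j) (ht : l ∈ deg k m t) :
    ∃ b ∈ Cech.locDeg x 𝒜 σ t, M.ofLoc σ b = l := by
  choose! c hc hc' using fun a (h : l.coeff a ≠ 0) =>
    M.exists_ofLoc_eq_single σ a (l.coeff a) (hl a h)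
  refine ⟨∑ a ∈ l.coeff.support, c a, sum_mem fun a ha => ?_, ?_⟩
  · have ha' := Finsupp.mem_support_iff.1 ha
    have : ∑ j, a j = t := by
      by_contra h'
      exact ha' (ht a h')
    exact this ▸ hc a ha'
  · conv_rhs => rw [← sum_single l]
    rw [map_sum]
    exact Finset.sum_congr rfl fun a ha => hc' a (Finsupp.mem_support_iff.1 ha)

end PolyModel

end Localization

section Homotopy

variable {k : Type*} [Field k] {m : ℕ} {A : Type*} [CommRing A] {x : Fin m → A}
  {𝒜 : ℕ → AddSubgroup A} {ι : A →+* MvLaurent k m} (M : PolyModel x 𝒜 ι)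

/-- A cochain as a family of Laurent polynomials. -/
noncomputable def PolyModel.family {i : ℕ} (α : Cech.C x i) (ρ : Finset (Fin m)) :
    MvLaurent k m :=
  if h : ρ.card = i then M.ofLoc ρ (α ⟨ρ, h⟩) else 0

theorem PolyModel.family_of_card {i : ℕ} (α : Cech.C x i) (σ : {σ : Finset (Fin m) // σ.card = i}) :
    M.family α σ.1 = M.ofLoc σ.1 (α σ) := dif_pos σ.2

theorem PolyModel.coeff_family_eq_zero {i : ℕ} (α : Cech.C x i) {ρ : Finset (Fin m)}
    {a : Fin m → ℤ} {j : Fin m} (hj : j ∉ ρ) (ha : a j < 0) :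
    (M.family α ρ).coeff a = 0 := by
  rw [PolyModel.family]
  split_ifs
  · exact M.coeff_ofLoc_eq_zero _ hj ha
  · rfl

theorem PolyModel.ofLoc_extend {i : ℕ} (α : Cech.C x i) {σ ρ : Finset (Fin m)} (h : ρ ⊆ σ) :
    M.ofLoc σ (Cech.extend _ α σ ρ) = M.family α ρ := by
  by_cases hc : ρ.card = i
  · rw [Cech.extend, PolyModel.family, dif_pos ⟨hc, h⟩, dif_pos hc, M.ofLoc_res]
  · rw [Cech.extend, PolyModel.family, dif_neg fun h => hc h.1, dif_neg hc, map_zero]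

/-- The sign of `j` in `σ`. -/
def sgn (k : Type*) [Field k] {m : ℕ} (j : Fin m) (σ : Finset (Fin m)) : k :=
  (-1) ^ (σ.filter (· < j)).card

theorem sgn_mul_self {m : ℕ} (j : Fin m) (σ : Finset (Fin m)) : sgn k j σ * sgn k j σ = 1 := by
  rw [sgn, ← mul_pow]
  simp

theorem sgn_swap {m : ℕ} {σ : Finset (Fin m)} {j l : Fin m} (hj : j ∈ σ) (hl : l ∈ σ)
    (h : j ≠ l) : sgn k j σ * sgn k l (σ.erase j) = -(sgn k l σ * sgn k j (σ.erase l)) :=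
  Cech.sign_swap hj hl h

/-- The Čech complex splits exponent by exponent into complexes of `k`-valued functions on sets of
variables, so exactness can be checked one exponent at a time. -/
theorem PolyModel.coeff_ofLoc_d {i : ℕ} (α : Cech.C x i)
    (σ : {σ : Finset (Fin m) // σ.card = i + 1}) (a : Fin m → ℤ) :
    (M.ofLoc σ.1 (Cech.d _ i α σ)).coeff a =
      ∑ j ∈ σ.1, sgn k j σ.1 * (M.family α (σ.1.erase j)).coeff a := by
  rw [Cech.d_apply_eq_sum, map_sum, AddMonoidAlgebra.coeff_sum, Finsupp.finsetSum_apply]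
  refine Finset.sum_congr rfl fun j _ => ?_
  rw [M.ofLoc_smul, M.ofLoc_extend α (Finset.erase_subset _ _), sgn, map_pow, map_neg, map_one]
  rcases Nat.even_or_odd (σ.1.filter (· < j)).card with h | h
  · rw [h.neg_one_pow, h.neg_one_pow, one_mul, one_mul]
  · rw [h.neg_one_pow, h.neg_one_pow]
    simp

/-- For each exponent this picks the vertex along which its complex is contracted. -/
theorem exists_nonneg_choice [NeZero m] : ∃ J : (Fin m → ℤ) → Fin m,
    ∀ a : Fin m → ℤ, (∃ j, 0 ≤ a j) → 0 ≤ a (J a) := by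
  classical
  refine ⟨fun a => if h : ∃ j, 0 ≤ a j then h.choose else 0, fun a h => ?_⟩
  beta_reduce
  rw [dif_pos h]
  exact h.choose_spec

/-- The part of a Laurent polynomial with exponents in a set. -/
noncomputable def restrictExp (P : (Fin m → ℤ) → Prop) (l : MvLaurent k m) :
    MvLaurent k m :=
  haveI := Classical.decPred P
  .ofCoeff (l.coeff.filter P)

open Classical in
theorem coeff_restrictExp (P : (Fin m → ℤ) → Prop) (l : MvLaurent k m)
    (a : Fin m → ℤ) : (restrictExp P l).coeff a = if P a then l.coeff a else 0 := by
  rw [restrictExp, AddMonoidAlgebra.coeff_ofCoeff, Finsupp.filter_apply]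

/-- Exactness of the Čech complex of the polynomial ring outside of the monomials with all
exponents negative. -/
theorem PolyModel.exists_d_eq [NeZero m] {i : ℕ} {α : Cech.C x (i + 1)} (hα : Cech.d _ (i + 1) α = 0)
    (hneg : ∀ σ a, (∀ j, a j < 0) → (M.family α σ).coeff a = 0) :
    ∃ β : Cech.C x i, Cech.d _ i β = α := by
  classical
  obtain ⟨J, hJ⟩ := exists_nonneg_choice (m := m)
  -- The contracting homotopy: at exponent a the value on ρ is ± the value of α on ρ ∪ {J a}, and
  -- zero if J a ∈ ρ.
  let b : Finset (Fin m) → MvLaurent k m := fun ρ =>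
    ∑ j ∈ ρᶜ, sgn k j (insert j ρ) • restrictExp (fun a => J a = j) (M.family α (insert j ρ))
  have hb : ∀ ρ a, (b ρ).coeff a = if J a ∈ ρ then 0 else
      sgn k (J a) (insert (J a) ρ) * (M.family α (insert (J a) ρ)).coeff a := by
    intro ρ a
    simp only [b, AddMonoidAlgebra.coeff_sum, Finsupp.finsetSum_apply, AddMonoidAlgebra.coeff_smul,
      Finsupp.smul_apply, smul_eq_mul, coeff_restrictExp, mul_ite, mul_zero]
    rw [Finset.sum_ite_eq]
    simp
  have hex : ∀ ρ : {ρ : Finset (Fin m) // ρ.card = i}, ∃ β, M.ofLoc ρ.1 β = b ρ.1 := by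
    intro ρ
    -- Values on ρ ∪ {J a} may have a negative exponent outside ρ only at J a, and there the
    -- exponent is nonnegative since all-negative exponents are excluded by `hneg`.
    refine M.exists_ofLoc_eq ρ.1 _ fun a ha l hl => ?_
    rw [hb] at ha
    split_ifs at ha with h
    · exact absurd rfl ha
    have hc := right_ne_zero_of_mul ha
    by_contra hneg'
    push Not at hneg'
    by_cases hlJ : l = J a
    · have := hJ a (by
        by_contra hall
        push Not at hall
        exact hc (hneg _ a hall))
      rw [← hlJ] at this
      omega
    · exact hc (M.coeff_family_eq_zero α (j := l) (by simp [hlJ, hl]) hneg')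
  choose β hβ using hex
  have hfam : ∀ ρ, ρ.card = i → M.family (i := i) β ρ = b ρ := fun ρ hρ =>
    (M.family_of_card (i := i) β ⟨ρ, hρ⟩).trans (hβ ⟨ρ, hρ⟩)
  refine ⟨β, ?_⟩
  funext σ
  apply M.ofLoc_injective
  ext a
  rw [M.coeff_ofLoc_d, ← M.family_of_card]
  have hcard : ∀ l ∈ σ.1, (σ.1.erase l).card = i := fun l hl => by
    rw [Finset.card_erase_of_mem hl, σ.2]
    rfl
  -- If J a ∈ σ, only the face omitting J a contributes. Otherwise the cocycle condition on σ ∪ {J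
  -- a} expresses the value on σ through the faces that contain J a.
  by_cases hj : J a ∈ σ.1
  · rw [Finset.sum_eq_single (J a)]
    · rw [hfam _ (hcard _ hj), hb, if_neg (Finset.notMem_erase _ _), Finset.insert_erase hj,
        ← mul_assoc, sgn_mul_self, one_mul]
    · intro l hl hne
      rw [hfam _ (hcard _ hl), hb, if_pos (Finset.mem_erase.2 ⟨hne.symm, hj⟩), mul_zero]
    · exact fun h => absurd hj h
  · let τ : {τ : Finset (Fin m) // τ.card = i + 1 + 1} :=
      ⟨insert (J a) σ.1, by rw [Finset.card_insert_of_notMem hj, σ.2]⟩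
    have hcoc : ∑ l ∈ τ.1, sgn k l τ.1 * (M.family α (τ.1.erase l)).coeff a = 0 := by
      rw [← M.coeff_ofLoc_d, hα]
      simp
    have hins : ∑ l ∈ τ.1, sgn k l τ.1 * (M.family α (τ.1.erase l)).coeff a =
        sgn k (J a) τ.1 * (M.family α σ.1).coeff a +
          ∑ l ∈ σ.1, sgn k l τ.1 * (M.family α (τ.1.erase l)).coeff a := by
      change ∑ l ∈ insert (J a) σ.1, _ = _
      rw [Finset.sum_insert hj]
      change sgn k (J a) τ.1 * (M.family α ((insert (J a) σ.1).erase (J a))).coeff a + _ = _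
      rw [Finset.erase_insert hj]
    have hterm : ∀ l ∈ σ.1, sgn k l σ.1 * (M.family (i := i) β (σ.1.erase l)).coeff a =
        -(sgn k (J a) τ.1) * (sgn k l τ.1 * (M.family α (τ.1.erase l)).coeff a) := by
      intro l hl
      have hne : J a ≠ l := fun h => hj (h ▸ hl)
      have he : insert (J a) (σ.1.erase l) = τ.1.erase l :=
        (Finset.erase_insert_of_ne hne).symm
      rw [hfam _ (hcard _ hl), hb, if_neg fun h => hj (Finset.mem_of_mem_erase h), he]
      have hs := sgn_swap (k := k) (σ := τ.1) (Finset.mem_insert_self _ _)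
        (Finset.mem_insert_of_mem hl) hne
      rw [show τ.1.erase (J a) = σ.1 from Finset.erase_insert hj] at hs
      have h2 := sgn_mul_self (k := k) (J a) τ.1
      have h3 := sgn_mul_self (k := k) (J a) (τ.1.erase l)
      linear_combination (M.family α (τ.1.erase l)).coeff a *
        (sgn k (J a) τ.1 * sgn k (J a) (τ.1.erase l) * hs - sgn k l σ.1 * sgn k (J a) (τ.1.erase l) * h2
          - sgn k (J a) τ.1 * sgn k l τ.1 * h3)
    rw [Finset.sum_congr rfl hterm, ← Finset.mul_sum]
    rw [hins] at hcoc
    linear_combination (M.family α σ.1).coeff a * sgn_mul_self (k := k) (J a) τ.1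
      - sgn k (J a) τ.1 * hcoc

end Homotopy

end MvLaurent

namespace MvLaurent

variable {k : Type*} [Field k]

/-- The polynomial ring, as its quotient by zero, inside of the Laurent polynomials. -/
noncomputable def ofQuot (k : Type*) [Field k] (n : ℕ) :
    (MvPolynomial (Fin (n + 1)) k ⧸ (⊥ : Ideal (MvPolynomial (Fin (n + 1)) k))) →+*
      MvLaurent k (n + 1) :=
  Ideal.Quotient.lift ⊥ (ofPoly k (n + 1)) fun a ha => by rw [Ideal.mem_bot.1 ha, map_zero]

theorem ofQuot_mk {n : ℕ} (s : MvPolynomial (Fin (n + 1)) k) :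
    ofQuot k n (Ideal.Quotient.mk ⊥ s) = ofPoly k (n + 1) s := rfl

theorem polyModel_ofQuot (k : Type*) [Field k] (n : ℕ) :
    PolyModel (quotX (⊥ : Ideal (MvPolynomial (Fin (n + 1)) k))) (quotDeg ⊥) (ofQuot k n) where
  injective := by
    refine (injective_iff_map_eq_zero _).2 fun a ha => ?_
    obtain ⟨s, rfl⟩ := Ideal.Quotient.mk_surjective a
    rw [ofQuot_mk] at ha
    rw [ofPoly_injective (ha.trans (map_zero _).symm), map_zero]
  map_x j := by rw [ofQuot_mk, ofPoly_X]
  coeff_eq_zero a b j hj := by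
    obtain ⟨s, rfl⟩ := Ideal.Quotient.mk_surjective a
    exact coeff_ofPoly_of_neg s hj
  mem_deg := by
    rintro e _ ⟨s, hs, rfl⟩
    exact ofPoly_isHomogeneous_mem_deg hs
  exists_eq u r := ⟨_, ⟨monomial u r, isHomogeneous_monomial r rfl, rfl⟩, ofPoly_monomial u r⟩

namespace PolyModel

variable {n : ℕ} {A : Type*} [CommRing A] {x : Fin (n + 1) → A}
  {𝒜 : ℕ → AddSubgroup A} {ι : A →+* MvLaurent k (n + 1)} (M : PolyModel x 𝒜 ι)

include M in
-- Below the top index every σ omits a variable, so no component of a cochain has a monomial with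
-- all exponents negative, and the contraction applies.
theorem Z_le_B {i : ℕ} (hi : i < n + 1) : Cech.Z x i ≤ Cech.B x i := by
  intro α hα
  rw [LinearMap.mem_ker] at hα
  cases i with
  | zero =>
    rw [Cech.B, Submodule.mem_bot]
    funext σ
    apply M.ofLoc_injective
    ext a
    -- The component of the differential at {0} is the single component of a 0-cochain, with sign
    -- +1.
    have h := M.coeff_ofLoc_d α ⟨{0}, rfl⟩ a
    rw [hα] at h
    have hσ : σ = ⟨∅, rfl⟩ := Subtype.ext (Finset.card_eq_zero.1 σ.2)
    subst hσ
    rw [← M.family_of_card]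
    simpa [sgn, Finset.filter_singleton] using h.symm
  | succ i =>
    refine M.exists_d_eq hα fun σ a ha => ?_
    by_cases hσ : σ.card = i + 1
    · obtain ⟨j, hj⟩ : ∃ j, j ∉ σ := by
        by_contra! h
        rw [Finset.eq_univ_of_forall h, Finset.card_univ, Fintype.card_fin] at hσ
        omega
      exact M.coeff_family_eq_zero α hj (ha j)
    · rw [PolyModel.family, dif_neg hσ]
      rfl

/-- A top-dimensional cochain as a class of Laurent polynomials. -/
noncomputable def topClass : Cech.C x (n + 1) →+ Top k (n + 1) where
  toFun α := (nonneg k (n + 1)).mkQ (M.ofLoc Finset.univ (α ⟨Finset.univ, by simp⟩))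
  map_zero' := by rw [Pi.zero_apply, map_zero, map_zero]
  map_add' α β := by rw [Pi.add_apply, map_add, map_add]

theorem topClass_apply (α : Cech.C x (n + 1)) : M.topClass α =
    (nonneg k (n + 1)).mkQ (M.ofLoc Finset.univ (α ⟨Finset.univ, by simp⟩)) := rfl

theorem topClass_eq_zero_iff {α : Cech.C x (n + 1)} (hα : α ∈ Cech.Z x (n + 1)) :
    M.topClass α = 0 ↔ α ∈ Cech.B x (n + 1) := by
  rw [topClass_apply, Submodule.mkQ_apply, Submodule.Quotient.mk_eq_zero, mem_nonneg]
  constructor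
  · intro h
    refine M.exists_d_eq (LinearMap.mem_ker.1 hα) fun σ a ha => ?_
    by_cases hσ : σ.card = n + 1
    · have : σ = Finset.univ := Finset.card_eq_iff_eq_univ σ |>.1 (by simpa using hσ)
      subst this
      rw [M.family_of_card α ⟨Finset.univ, hσ⟩]
      exact h a ha
    · rw [PolyModel.family, dif_neg hσ]
      rfl
  · rintro ⟨β, rfl⟩ a ha
    rw [M.coeff_ofLoc_d β ⟨Finset.univ, by simp⟩]
    -- The j-th face does not invert x_j, so it has no monomials with negative j-th exponent.
    refine Finset.sum_eq_zero fun j _ => ?_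
    rw [M.coeff_family_eq_zero β (Finset.notMem_erase j _) (ha j), mul_zero]

theorem topClass_smul {r : A} {s : MvPolynomial (Fin (n + 1)) k} (h : ι r = ofPoly k (n + 1) s)
    (α : Cech.C x (n + 1)) : M.topClass (r • α) = s • M.topClass α := by
  rw [topClass_apply, topClass_apply, Pi.smul_apply, M.ofLoc_smul, h]
  rfl

theorem topClass_frobC (p : ℕ) [Fact p.Prime] [CharP k p] (hp : (p : A) = 0)
    (α : Cech.C x (n + 1)) :
    M.topClass (Cech.frobC x p hp (n + 1) α) = frobTop k (n + 1) p (M.topClass α) := by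
  rw [topClass_apply, topClass_apply, frobTop_mk, ← map_pow]
  rfl

theorem topClass_mem {t : ℤ} {α : Cech.C x (n + 1)} (hα : α ∈ Cech.CDeg x 𝒜 (n + 1) t) :
    M.topClass α ∈ topDeg k (n + 1) t := by
  have h := M.ofLoc_mem_deg (Cech.mem_CDeg.1 hα ⟨Finset.univ, by simp⟩)
  exact AddSubgroup.mem_map_of_mem (nonneg k (n + 1)).mkQ.toAddMonoidHom h

theorem exists_topClass_eq {t : ℤ} {η : Top k (n + 1)} (hη : η ∈ topDeg k (n + 1) t) :
    ∃ α ∈ Cech.CDeg x 𝒜 (n + 1) t, M.topClass α = η := by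
  obtain ⟨l, hl, rfl⟩ := hη
  have h : ∀ σ : {σ : Finset (Fin (n + 1)) // σ.card = n + 1},
      ∃ b ∈ Cech.locDeg x 𝒜 σ.1 t, M.ofLoc σ.1 b = l := by
    intro σ
    refine M.exists_ofLoc_eq_of_mem_deg σ.1 (fun a _ j hj => absurd ?_ hj) hl
    rw [(Finset.card_eq_iff_eq_univ σ.1).1 (by simpa using σ.2)]
    exact Finset.mem_univ j
  choose α hα hα' using h
  refine ⟨α, Cech.mem_CDeg.2 hα, ?_⟩
  exact congrArg (nonneg k (n + 1)).mkQ (hα' ⟨Finset.univ, by simp⟩)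

omit M in
theorem mem_Z_top (α : Cech.C x (n + 1)) : α ∈ Cech.Z x (n + 1) := by
  rw [LinearMap.mem_ker]
  funext σ
  have := Finset.card_le_univ σ.1
  rw [σ.2, Fintype.card_fin] at this
  omega

end PolyModel

/-- The local cohomology of the polynomial ring. -/
theorem nonempty_dualityMap_bot (p : ℕ) [Fact p.Prime] [CharP k p] (n : ℕ) :
    Nonempty (DualityMap (n := n) (k := k) p ⊥ (n + 1) 0 1) := by
  have M := polyModel_ofQuot k n
  refine ⟨⟨fun i hi => M.Z_le_B hi, M.topClass.comp (Cech.Z _ _).subtype.toAddMonoidHom,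
    fun α => M.topClass_eq_zero_iff α.2, fun s α => ?_, fun α => ?_, fun t α hα => ?_,
    fun t η hη _ => ?_⟩⟩
  · exact M.topClass_smul (ofQuot_mk s) α.1
  · rw [one_pow, one_smul]
    exact M.topClass_frobC p (quot_natCast_eq_zero p _) α.1
  · rw [sub_zero]
    exact M.topClass_mem (t := t) (Cech.mem_ZDeg.1 hα)
  · rw [sub_zero] at hη
    have h := M.exists_topClass_eq (t := t) (η := η) hη
    refine h.elim fun α hα => ?_
    refine ⟨⟨α, PolyModel.mem_Z_top α⟩, Cech.mem_ZDeg.2 hα.1, ?_⟩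
    exact hα.2

end MvLaurent

namespace MvLaurent

variable {k : Type*} [Field k] {m : ℕ}

theorem degree_eq_of_isHomogeneous {s : MvPolynomial (Fin m) k} {e : ℕ} (hs : s.IsHomogeneous e)
    {u : Fin m →₀ ℕ} (hu : u ∈ s.support) : u.degree = e := by
  have := hs (mem_support_iff.1 hu)
  rwa [show Finsupp.weight (1 : Fin m → ℕ) = Finsupp.degree from
    Finsupp.degree_eq_weight_one.symm] at this

theorem coeff_smul (s : MvPolynomial (Fin m) k) (l : MvLaurent k m) (a : Fin m → ℤ) :
    (s • l).coeff a = ∑ u ∈ s.support, s.coeff u * l.coeff (a - expCast m u) := by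
  conv_lhs => rw [s.as_sum, Finset.sum_smul]
  rw [AddMonoidAlgebra.coeff_sum, Finsupp.finsetSum_apply]
  exact Finset.sum_congr rfl fun u _ => coeff_monomial_smul u _ l a

/-! ### Homogeneous components -/

section Component

/-- The component of degree `t` of a Laurent polynomial. -/
noncomputable def component (t : ℤ) : MvLaurent k m →+ MvLaurent k m where
  toFun l := restrictExp (fun a => ∑ j, a j = t) l
  map_zero' := by
    classical
    ext a
    rw [coeff_restrictExp]
    simp
  map_add' l l' := by
    classical
    ext a
    simp only [AddMonoidAlgebra.coeff_add, Finsupp.add_apply, coeff_restrictExp]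
    split_ifs <;> simp

theorem coeff_component (t : ℤ) (l : MvLaurent k m) (a : Fin m → ℤ) :
    (component t l).coeff a = if ∑ j, a j = t then l.coeff a else 0 := by
  refine (coeff_restrictExp _ l a).trans ?_
  congr

theorem component_smul {s : MvPolynomial (Fin m) k} {e : ℕ} (hs : s.IsHomogeneous e) (t : ℤ)
    (l : MvLaurent k m) : component (t + e) (s • l) = s • component t l := by
  ext a
  have h : ∀ u ∈ s.support, ∑ j, (a - expCast m u) j = t ↔ ∑ j, a j = t + e := by
    intro u hu
    rw [← degree_eq_of_isHomogeneous hs hu, ← sum_expCast]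
    simp only [Pi.sub_apply, Finset.sum_sub_distrib]
    omega
  have h' : (s • component t l).coeff a = ∑ u ∈ s.support, s.coeff u *
      (if ∑ j, a j = t + e then l.coeff (a - expCast m u) else 0) := by
    rw [coeff_smul]
    refine Finset.sum_congr rfl fun u hu => ?_
    rw [coeff_component, if_congr (h u hu) rfl rfl]
  rw [coeff_component, h', coeff_smul]
  split_ifs
  · rfl
  · simp

/-- The component of degree `t` of a class. -/
noncomputable def topComponent (t : ℤ) : Top k m →+ Top k m :=
  QuotientAddGroup.map (nonneg k m).toAddSubgroup (nonneg k m).toAddSubgroup (component t)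
    fun l hl a ha => by
      rw [coeff_component, hl a ha, ite_self]

theorem topComponent_mkQ (t : ℤ) (l : MvLaurent k m) :
    topComponent t ((nonneg k m).mkQ l) = (nonneg k m).mkQ (component t l) := rfl

theorem topComponent_smul {s : MvPolynomial (Fin m) k} {e : ℕ} (hs : s.IsHomogeneous e) (t : ℤ)
    (η : Top k m) : topComponent (t + e) (s • η) = s • topComponent t η := by
  obtain ⟨l, rfl⟩ := (nonneg k m).mkQ_surjective η
  rw [topComponent_mkQ, ← map_smul, ← map_smul, topComponent_mkQ, component_smul hs]

theorem topComponent_mem (t : ℤ) (η : Top k m) : topComponent t η ∈ topDeg k m t := by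
  obtain ⟨l, rfl⟩ := (nonneg k m).mkQ_surjective η
  refine ⟨component t l, fun a ha => ?_, rfl⟩
  rw [coeff_component, if_neg ha]

theorem topComponent_of_ne {s t : ℤ} (h : s ≠ t) {η : Top k m} (hη : η ∈ topDeg k m s) :
    topComponent t η = 0 := by
  obtain ⟨l, hl, rfl⟩ := hη
  refine (topComponent_mkQ t l).trans ?_
  have : component t l = 0 := by
    ext a
    rw [coeff_component]
    split_ifs with h'
    · exact hl a (h'.trans_ne h.symm)
    · rfl
  rw [this, map_zero]

theorem eq_zero_of_topComponent {η : Top k m} (h : ∀ t, topComponent t η = 0) : η = 0 := by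
  obtain ⟨l, rfl⟩ := (nonneg k m).mkQ_surjective η
  rw [Submodule.mkQ_apply, Submodule.Quotient.mk_eq_zero, mem_nonneg]
  intro a ha
  have h1 := h (∑ j, a j)
  rw [topComponent_mkQ, Submodule.mkQ_apply, Submodule.Quotient.mk_eq_zero, mem_nonneg] at h1
  have h2 := h1 a ha
  rwa [coeff_component, if_pos rfl] at h2

/-- A class in degrees less than `N` that is killed by a set of forms is zero if this holds for
homogeneous classes. -/
theorem eq_zero_of_mem_iSup_topDeg {N : ℤ} {G : Set (MvPolynomial (Fin m) k)}
    (hG : ∀ g ∈ G, ∃ e, g.IsHomogeneous e)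
    (h : ∀ t < N, ∀ η ∈ topDeg k m t, (∀ g ∈ G, g • η = 0) → η = 0) {η : Top k m}
    (hη : η ∈ ⨆ t : {t : ℤ // t < N}, topDeg k m t.1) (hGη : ∀ g ∈ G, g • η = 0) : η = 0 := by
  refine eq_zero_of_topComponent fun t => ?_
  by_cases ht : t < N
  · refine h t ht _ (topComponent_mem t η) fun g hg => ?_
    obtain ⟨e, he⟩ := hG g hg
    rw [← topComponent_smul he, hGη g hg, map_zero]
  · refine AddSubgroup.iSup_induction _ (C := fun η => topComponent t η = 0) hη ?_ (map_zero _) ?_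
    · intro s η hη
      exact topComponent_of_ne (fun h : s.1 = t => ht (h ▸ s.2)) hη
    · intro η η' h1 h2
      rw [map_add, h1, h2, add_zero]

end Component

/-! ### Graded duality -/

section Duality

/-- The class with a prescribed linear form on the polynomials of degree `e`. -/
noncomputable def dualClass (e : ℕ) (θ : MvPolynomial (Fin m) k →ₗ[k] k) : MvLaurent k m :=
  ∑ u ∈ (Finset.univ : Finset (Fin m)).finsuppAntidiag e,
    AddMonoidAlgebra.single (-expCast m u - 1) (θ (monomial u 1))

theorem mem_finsuppAntidiag_univ {e : ℕ} {u : Fin m →₀ ℕ} :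
    u ∈ (Finset.univ : Finset (Fin m)).finsuppAntidiag e ↔ u.degree = e := by
  simp [Finset.mem_finsuppAntidiag, Finsupp.degree_eq_sum]

theorem coeff_dualClass (e : ℕ) (θ : MvPolynomial (Fin m) k →ₗ[k] k) (v : Fin m →₀ ℕ) :
    (dualClass e θ).coeff (-expCast m v - 1) = if v.degree = e then θ (monomial v 1) else 0 := by
  have h : ∀ u, -expCast m u - 1 = -expCast m v - 1 ↔ u = v := fun u => by
    rw [sub_left_inj, neg_inj, expCast_injective.eq_iff]
  simp only [dualClass, AddMonoidAlgebra.coeff_sum, Finsupp.finsetSum_apply,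
    AddMonoidAlgebra.coeff_single, Finsupp.single_apply, h]
  rw [Finset.sum_ite_eq']
  simp only [mem_finsuppAntidiag_univ]

theorem dualClass_mem_deg (e : ℕ) (θ : MvPolynomial (Fin m) k →ₗ[k] k) :
    dualClass e θ ∈ deg k m (-e - m) := by
  refine sum_mem fun u hu => ?_
  have := single_mem_deg (-expCast m u - 1) (θ (monomial u 1))
  have h : ∑ j, (-expCast m u - 1) j = -(e : ℤ) - m := by
    rw [← mem_finsuppAntidiag_univ.1 hu, ← sum_expCast]
    simp [Finset.sum_sub_distrib]
  rwa [h] at this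

theorem exists_eq_neg_sub_one {a : Fin m → ℤ} (ha : ∀ j, a j < 0) :
    ∃ v, a = -expCast m v - 1 := by
  obtain ⟨v, hv⟩ := exists_expCast_eq (a := -a - 1) fun j => by
    have := ha j
    simp only [Pi.sub_apply, Pi.neg_apply, Pi.one_apply]
    omega
  exact ⟨v, by rw [hv]; ring⟩

/-- Outside of a homogeneous ideal, forms are detected by classes killed by the ideal. -/
theorem exists_ne_zero_of_notMem {I : Ideal (MvPolynomial (Fin m) k)} (hI : I.GeneratedByForms)
    {s : MvPolynomial (Fin m) k} {e : ℕ} (hs : s.IsHomogeneous e) (hsI : s ∉ I) :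
    ∃ η ∈ topDeg k m (-e - m), η ≠ 0 ∧ ∀ g ∈ I, g • η = 0 := by
  -- The class is dual to a linear form that vanishes on the ideal but not at `s`.
  obtain ⟨θ, hθ, hIθ⟩ := Submodule.exists_le_ker_of_notMem (p := I.restrictScalars k) hsI
  obtain ⟨G, hG, rfl⟩ := hI
  refine ⟨_, ⟨_, dualClass_mem_deg e θ, rfl⟩, fun h => hθ ?_, fun g hg => ?_⟩
  · have h0 : dualClass e θ ∈ nonneg k m := (Submodule.Quotient.mk_eq_zero _).1 h
    rw [s.as_sum, map_sum]
    refine Finset.sum_eq_zero fun u hu => ?_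
    have h1 := h0 (-expCast m u - 1) fun j => by
      simp only [Pi.sub_apply, Pi.neg_apply, Pi.one_apply, expCast_apply]
      omega
    rw [coeff_dualClass, if_pos (degree_eq_of_isHomogeneous hs hu)] at h1
    rw [← mul_one (coeff u s), ← smul_eq_mul, ← smul_monomial, map_smul, h1, smul_zero]
  · induction hg using Submodule.span_induction with
    | zero => rw [zero_smul]
    | add x y _ _ hx hy => rw [add_smul, hx, hy, add_zero]
    | smul r x _ hx => rw [smul_eq_mul, mul_smul, hx, smul_zero]
    | mem g hg =>
      obtain ⟨e', he'⟩ := hG g hg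
      refine ((nonneg k m).mkQ.map_smul g (dualClass e θ)).symm.trans ?_
      rw [Submodule.mkQ_apply, Submodule.Quotient.mk_eq_zero, mem_nonneg]
      intro a ha
      obtain ⟨v, rfl⟩ := exists_eq_neg_sub_one ha
      -- The coefficient of g times the class at -v - 1 is θ(x^v g) when x^v g has degree e, and
      -- zero otherwise; θ kills x^v g as it lies in the ideal.
      have key : ∀ u ∈ g.support, g.coeff u * (dualClass e θ).coeff (-expCast m v - 1 - expCast m u) =
          if v.degree + e' = e then θ (monomial (v + u) (g.coeff u)) else 0 := by
        intro u hu
        have h1 : -expCast m v - 1 - expCast m u = -expCast m (v + u) - 1 := by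
          rw [map_add]
          ring
        rw [h1, coeff_dualClass, map_add, degree_eq_of_isHomogeneous he' hu]
        split_ifs
        · rw [← smul_eq_mul, ← map_smul, smul_monomial, smul_eq_mul, mul_one]
        · rw [mul_zero]
      rw [coeff_smul, Finset.sum_congr rfl key]
      split_ifs
      · rw [← map_sum]
        have h2 : ∑ u ∈ g.support, monomial (v + u) (g.coeff u) = monomial v 1 * g := by
          conv_rhs => rw [g.as_sum, Finset.mul_sum]
          simp only [monomial_mul, one_mul]
        rw [h2]
        exact hIθ (Ideal.mul_mem_left _ _ (Ideal.subset_span hg))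
      · exact Finset.sum_const_zero

end Duality

/-! ### Regular sequences -/

section RegularSequence

variable {R : Type*} [CommRing R]

/-- A weakly regular sequence, in reversed order. -/
def RevRegular : List R → Prop
  | [] => True
  | g :: l => RevRegular l ∧ ∀ s, g * s ∈ Ideal.ofList l → s ∈ Ideal.ofList l

theorem ofList_reverse (l : List R) : Ideal.ofList l.reverse = Ideal.ofList l := by
  simp [Ideal.ofList]

/-- A regular sequence grows at its end and a list at its head; after reversal, induction on the
list adds the last element of the sequence. -/
theorem revRegular_reverse {l : List R} (h : RingTheory.Sequence.IsWeaklyRegular R l) :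
    RevRegular l.reverse := by
  induction l using List.reverseRecOn with
  | nil => trivial
  | append_singleton l g ih =>
    obtain ⟨h1, h2⟩ := (RingTheory.Sequence.isWeaklyRegular_append_iff R l [g]).1 h
    rw [RingTheory.Sequence.isWeaklyRegular_singleton_iff] at h2
    rw [List.reverse_append, List.reverse_singleton, List.singleton_append]
    refine ⟨ih h1, fun s hs => ?_⟩
    rw [ofList_reverse] at hs ⊢
    have h3 : ∀ s, s ∈ (Ideal.ofList l • ⊤ : Submodule R R) ↔ s ∈ Ideal.ofList l := fun s => by
      rw [smul_eq_mul, Ideal.mul_top]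
    rw [← h3, ← Submodule.Quotient.mk_eq_zero] at hs ⊢
    exact h2.right_eq_zero_of_smul hs

end RegularSequence

section DualityMap

variable {n : ℕ} (p : ℕ) [Fact p.Prime] [CharP k p]

theorem generatedByForms_ofList {l : List (MvPolynomial (Fin m) k × ℕ)}
    (hl : ∀ g ∈ l, g.1.IsHomogeneous g.2) : (Ideal.ofList (l.map Prod.fst)).GeneratedByForms := by
  refine ⟨_, fun g hg => ?_, rfl⟩
  obtain ⟨x, hx, rfl⟩ := List.mem_map.1 hg
  exact ⟨x.2, hl x hx⟩

/-- The induction starts from the polynomial ring at index n + 1, and each form lowers the index by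
one. -/
theorem nonempty_dualityMap {l : List (MvPolynomial (Fin (n + 1)) k × ℕ)}
    (hl : ∀ g ∈ l, g.1.IsHomogeneous g.2) (hreg : RevRegular (l.map Prod.fst)) {i : ℕ}
    (hi : i + l.length = n + 1) :
    Nonempty (DualityMap p (Ideal.ofList (l.map Prod.fst)) i ((l.map Prod.snd).sum : ℕ)
      (l.map Prod.fst).prod) := by
  induction l generalizing i with
  | nil =>
    obtain rfl : i = n + 1 := by simpa using hi
    simpa using nonempty_dualityMap_bot p n
  | cons g l ih =>
    obtain ⟨D⟩ := ih (fun x hx => hl x (List.mem_cons_of_mem _ hx)) hreg.1 (i := i + 1)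
      (by rw [List.length_cons] at hi; omega)
    have h := D.quotient (generatedByForms_ofList fun x hx => hl x (List.mem_cons_of_mem _ hx))
      (hl g List.mem_cons_self) hreg.2
    rw [List.map_cons, List.map_cons, List.prod_cons, List.sum_cons, Ideal.ofList_cons, sup_comm,
      Nat.cast_add, add_comm (g.2 : ℤ)]
    exact h

variable {p} in
/-- A quotient with nonzero local cohomology in degree zero has no regular forms. -/
theorem DualityMap.false_of_regular {J : Ideal (MvPolynomial (Fin (n + 1)) k)}
    (hJ : J.GeneratedByForms) {d : ℤ} {q : MvPolynomial (Fin (n + 1)) k} (D : DualityMap p J 0 d q)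
    {g : MvPolynomial (Fin (n + 1)) k} {δ : ℕ} (hδ : g.IsHomogeneous δ)
    (hg : ∀ s, g * s ∈ J → s ∈ J) (hne : J ⊔ Ideal.span {g} ≠ ⊤) : False := by
  obtain ⟨η, hη, hη0, hkill⟩ := exists_ne_zero_of_notMem (hJ.sup_span_singleton hδ)
    (isHomogeneous_one _ _) ((Ideal.ne_top_iff_one _).1 hne)
  obtain ⟨α, -, rfl⟩ := D.exists_eq (-(0 : ℕ) - (n + 1 : ℕ) + d) η (by rwa [add_sub_cancel_right])
    fun s hs => hkill s (Ideal.mem_sup_left hs)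
  refine hη0 ?_
  have h1 := hkill g (Ideal.mem_sup_right (Ideal.mem_span_singleton_self g))
  rw [← D.map_smul, D.eq_zero_iff, Cech.B, Submodule.mem_bot] at h1
  rw [D.eq_zero_iff, Cech.B, Submodule.mem_bot]
  -- At index zero there are no nonzero coboundaries, so `g` kills the cochain itself, which
  -- contradicts regularity unless the cochain is zero.
  exact Cech.cochain_smul_eq_zero (regularQuotient_factor le_sup_left rfl hg).regular h1

include p in
theorem length_le_of_revRegular {l : List (MvPolynomial (Fin (n + 1)) k × ℕ)}
    (hl : ∀ g ∈ l, g.1.IsHomogeneous g.2) (hreg : RevRegular (l.map Prod.fst))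
    (hne : Ideal.ofList (l.map Prod.fst) ≠ ⊤) : l.length ≤ n + 1 := by
  induction l with
  | nil => simp
  | cons g l ih =>
    have hl' : ∀ x ∈ l, x.1.IsHomogeneous x.2 := fun x hx => hl x (List.mem_cons_of_mem _ hx)
    rw [List.map_cons, Ideal.ofList_cons, sup_comm] at hne
    have h := ih hl' hreg.1 (ne_top_of_le_ne_top hne le_sup_left)
    rw [List.length_cons]
    by_contra hlen
    obtain ⟨D⟩ := nonempty_dualityMap p hl' hreg.1 (i := 0) (by omega)
    exact D.false_of_regular (generatedByForms_ofList hl') (hl g List.mem_cons_self) hreg.2 hne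

end DualityMap

end MvLaurent

namespace MvLaurent

/-! ## The ideal `τ` -/

section Tau

variable {k : Type*} [Field k] {m : ℕ} (p : ℕ) [Fact p.Prime] [CharP k p] {N c : ℕ}
  {e : Fin N → k} {θ : Fin N → k →+ k}

/-- Generators of `τ`: the `f_j` and the coordinates of `(f_1 ⋯ f_c) ^ (p - 1)` over the `p`-th
powers. -/
def tauGens (θ : Fin N → k →+ k) (f : Fin c → MvPolynomial (Fin m) k) :
    Set (MvPolynomial (Fin m) k) :=
  Set.range f ∪ Set.range fun bc : Fin N × (Fin m → Fin p) =>
    cartier p (θ bc.1) (digits m p bc.2) ((∏ j, f j) ^ (p - 1))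

theorem cartier_mem_of_mem_frobPow {I : Ideal (MvPolynomial (Fin m) k)}
    {g : MvPolynomial (Fin m) k} (hg : g ∈ I.frobPow p) {θ : k →+ k}
    (hθ : ∀ s y, θ (s ^ p * y) = s * θ y) {c : Fin m →₀ ℕ} (hc : ∀ j, c j < p) :
    cartier p θ c g ∈ I := by
  -- The operator is not linear over the polynomial ring, so the multiplier `r` has to be carried
  -- through the induction.
  suffices h : ∀ r, cartier p θ c (r * g) ∈ I by simpa using h 1
  induction hg using Submodule.span_induction with
  | zero => intro r; rw [mul_zero, map_zero]; exact I.zero_mem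
  | add x y _ _ hx hy => intro r; rw [mul_add, map_add]; exact I.add_mem (hx r) (hy r)
  | smul s x _ hx => intro r; rw [smul_eq_mul, ← mul_assoc]; exact hx (r * s)
  | mem x hx =>
    obtain ⟨a, ha, rfl⟩ := hx
    intro r
    rw [mul_comm, cartier_pow_mul p hθ hc]
    exact I.mul_mem_right _ ha

/-- The expansion in Cartier coordinates puts the product in the Frobenius power of the ideal they
generate; conversely, the operators carry I^{[p]} into I, so every competing ideal contains the
coordinates. -/
theorem isLeast_tauSet (hθ : ∀ b s y, θ b (s ^ p * y) = s * θ b y)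
    (hsum : ∀ y, ∑ b, θ b y ^ p * e b = y) (f : Fin c → MvPolynomial (Fin m) k) :
    IsLeast (tauSet p f) (Ideal.span (tauGens p θ f)) := by
  constructor
  · refine ⟨Ideal.span_mono Set.subset_union_left, ?_⟩
    rw [← sum_cartier p hsum ((∏ j, f j) ^ (p - 1))]
    refine sum_mem fun b _ => sum_mem fun c _ => Ideal.mul_mem_right _ _ (Ideal.subset_span ?_)
    exact ⟨_, Ideal.subset_span (Or.inr ⟨(b, c), rfl⟩), rfl⟩
  · intro I hI
    refine Ideal.span_le.2 (Set.union_subset ?_ ?_)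
    · exact Ideal.span_le.1 hI.1
    · rintro _ ⟨bc, rfl⟩
      exact cartier_mem_of_mem_frobPow p hI.2 (hθ bc.1) (digits_lt bc.2)

omit [CharP k p] in
theorem isHomogeneous_of_mem_tauGens {f : Fin c → MvPolynomial (Fin m) k} {deg : Fin c → ℕ}
    (hf : ∀ j, (f j).IsHomogeneous (deg j)) {g : MvPolynomial (Fin m) k}
    (hg : g ∈ tauGens p θ f) : ∃ e ≤ ∑ j, deg j, g.IsHomogeneous e := by
  rcases hg with ⟨j, rfl⟩ | ⟨bc, rfl⟩
  · exact ⟨deg j, Finset.single_le_sum (fun _ _ => Nat.zero_le _) (Finset.mem_univ j), hf j⟩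
  · refine ⟨_, ?_, isHomogeneous_cartier p _ _
      ((IsHomogeneous.prod _ _ _ fun j _ => hf j).pow (p - 1))⟩
    -- A coordinate has degree at most (p - 1)d / p, hence at most d.
    refine Nat.div_le_of_le_mul ((Nat.sub_le _ _).trans ?_)
    rw [mul_comm]
    exact Nat.mul_le_mul_right _ (Nat.sub_le _ _)

/-- The classes killed by the `f_j` and by the twisted Frobenius are those killed by `τ`. -/
theorem smul_frobTop_eq_zero_iff (hθ : ∀ b s y, θ b (s ^ p * y) = s * θ b y)
    (hsum : ∀ y, ∑ b, θ b y ^ p * e b = y) (f : Fin c → MvPolynomial (Fin m) k) {η : Top k m}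
    (hη : ∀ s ∈ Ideal.span (Set.range f), s • η = 0) :
    (∏ j, f j) ^ (p - 1) • frobTop k m p η = 0 ↔ ∀ g ∈ tauGens p θ f, g • η = 0 := by
  constructor
  · rintro h _ (⟨j, rfl⟩ | ⟨bc, rfl⟩)
    · exact hη _ (Ideal.subset_span ⟨j, rfl⟩)
    · exact cartier_smul_eq_zero p (hθ bc.1) (digits_lt bc.2) h
  · intro h
    rw [← sum_cartier p hsum ((∏ j, f j) ^ (p - 1)), Finset.sum_smul]
    refine Finset.sum_eq_zero fun b _ => ?_
    rw [Finset.sum_smul]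
    refine Finset.sum_eq_zero fun c _ => ?_
    -- A p-th power s^p moves inside the Frobenius as s, which kills η.
    rw [mul_comm, mul_smul, ← frobTop_smul, h _ (Or.inr ⟨(b, c), rfl⟩), map_zero, smul_zero]

end Tau

/-! ## Vanishing in low degrees -/

section Vanishing

variable {k : Type*} [Field k] {n : ℕ} {p : ℕ} [Fact p.Prime] [CharP k p]

/-- An element killed by all variables is a Čech cocycle. -/
theorem eq_zero_of_mul_quotX {J : Ideal (MvPolynomial (Fin (n + 1)) k)}
    (hZ : Cech.Z (quotX J) 0 ≤ Cech.B (quotX J) 0) {a : MvPolynomial (Fin (n + 1)) k ⧸ J}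
    (ha : ∀ j, quotX J j * a = 0) : a = 0 := by
  let α : Cech.C (quotX J) 0 := fun σ => algebraMap _ _ a
  have hα : α ∈ Cech.Z (quotX J) 0 := by
    rw [LinearMap.mem_ker]
    funext σ
    rw [Cech.d_apply]
    obtain ⟨j₀, hj₀⟩ := Finset.card_eq_one.1 σ.2
    have h0 : algebraMap _ (Cech.Loc (quotX J) σ.1) a = 0 := by
      rw [Cech.algebraMap_eq_zero_iff]
      refine ⟨1, ?_⟩
      rw [hj₀, Finset.prod_singleton, pow_one, ha]
    refine Finset.sum_eq_zero fun j _ => ?_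
    simp only [α, Cech.res_algebraMap, h0, smul_zero]
  have h1 := hZ hα
  rw [Cech.B, Submodule.mem_bot] at h1
  -- Localization at the empty set inverts only 1, so vanishing there gives a = 0.
  have h2 : algebraMap _ (Cech.Loc (quotX J) ∅) a = 0 := congrFun h1 ⟨∅, rfl⟩
  obtain ⟨N, hN⟩ := (Cech.algebraMap_eq_zero_iff _ _ _).1 h2
  simpa using hN

/-- Over an infinite field, a regular form of degree `D` exists in an ideal that is generated by
forms of degree at most `D` and not contained in primes other than the ideal of the variables. -/
theorem exists_regular_form [Infinite k] {J : Ideal (MvPolynomial (Fin (n + 1)) k)}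
    (hZ : Cech.Z (quotX J) 0 ≤ Cech.B (quotX J) 0) {D : ℕ}
    {G : Set (MvPolynomial (Fin (n + 1)) k)} (hG : ∀ g ∈ G, ∃ e ≤ D, g.IsHomogeneous e)
    (hprime : ∀ P : Ideal (MvPolynomial (Fin (n + 1)) k), P.IsPrime → G ⊆ P → ∀ j, X j ∈ P) :
    ∃ g ∈ Ideal.span G, g.IsHomogeneous D ∧ ∀ s, g * s ∈ J → s ∈ J := by
  by_contra! hcon
  let W : Submodule k (MvPolynomial (Fin (n + 1)) k) :=
    homogeneousSubmodule (Fin (n + 1)) k D ⊓ (Ideal.span G).restrictScalars k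
  let Ass := associatedPrimes (MvPolynomial (Fin (n + 1)) k) (MvPolynomial (Fin (n + 1)) k ⧸ J)
  have hfin : Finite Ass := associatedPrimes.finite _ _
  -- If every form of degree D in the ideal is a zero divisor, these forms are covered by the
  -- finitely many associated primes; over an infinite field a single prime P then contains them
  -- all.
  have hcover : ⋃ P : Ass, ((P.1.restrictScalars k).comap W.subtype : Set W) = Set.univ := by
    refine Set.eq_univ_of_forall fun g => ?_
    obtain ⟨s, hgs, hs⟩ := hcon g.1 g.2.2 g.2.1
    have h : g.1 ∈ ⋃ P ∈ Ass, (P : Set (MvPolynomial (Fin (n + 1)) k)) := by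
      rw [biUnion_associatedPrimes_eq_zero_divisors]
      refine ⟨Ideal.Quotient.mk J s, fun h => hs (Ideal.Quotient.eq_zero_iff_mem.1 h), ?_⟩
      exact Ideal.Quotient.eq_zero_iff_mem.2 hgs
    obtain ⟨P, hP, hgP⟩ := Set.mem_iUnion₂.1 h
    exact Set.mem_iUnion.2 ⟨⟨P, hP⟩, hgP⟩
  obtain ⟨⟨P, hP⟩, htop⟩ := Subspace.exists_eq_top_of_iUnion_eq_univ hcover
  have hWP : ∀ g ∈ W, g ∈ P := fun g hg => by
    have : (⟨g, hg⟩ : W) ∈ (P.restrictScalars k).comap W.subtype := by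
      rw [show (P.restrictScalars k).comap W.subtype = ⊤ from htop]
      trivial
    exact this
  obtain ⟨hPprime, a, hPa⟩ := isAssociatedPrime_iff.1 hP
  have hX : ∀ j, X j ∈ P := by
    by_contra! hj
    obtain ⟨j, hj⟩ := hj
    refine hj (hprime P hPprime (fun g hg => ?_) j)
    obtain ⟨e, he, hge⟩ := hG g hg
    -- A power of a variable outside P raises the generator to degree exactly D without affecting
    -- membership in P.
    have hmem : X j ^ (D - e) * g ∈ W := by
      refine ⟨?_, Ideal.mul_mem_left _ _ (Ideal.subset_span hg)⟩
      have := ((isHomogeneous_X k j).pow (D - e)).mul hge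
      rwa [one_mul, Nat.sub_add_cancel he] at this
    exact (hPprime.mem_or_mem (hWP _ hmem)).resolve_left
      fun h => hj (hPprime.mem_of_pow_mem _ h)
  -- P is the annihilator of `a`; containing all variables, it forces a = 0 by the vanishing of H^0,
  -- so P would be the unit ideal.
  have ha : a = 0 := by
    refine eq_zero_of_mul_quotX hZ fun j => ?_
    have h := hX j
    rw [hPa, Submodule.mem_colon_singleton, Submodule.mem_bot] at h
    exact h
  refine hPprime.ne_top ?_
  rw [hPa, ha]
  simp

/-- Classes of low degree that are killed by `J` and by forms of degree at most `D` vanish, if the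
forms cut out the ideal of the variables. -/
theorem DualityMap.eq_zero_of_infinite [Infinite k] {D : ℕ}
    {G : Set (MvPolynomial (Fin (n + 1)) k)} (hG : ∀ g ∈ G, ∃ e ≤ D, g.IsHomogeneous e)
    (hprime : ∀ P : Ideal (MvPolynomial (Fin (n + 1)) k), P.IsPrime → G ⊆ P → ∀ j, X j ∈ P)
    {i : ℕ} {J : Ideal (MvPolynomial (Fin (n + 1)) k)} (hJ : J.GeneratedByForms) {d : ℤ}
    {q : MvPolynomial (Fin (n + 1)) k} (M : DualityMap p J i d q) {t : ℤ} (ht : t + i * D < 0)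
    {η : Top k (n + 1)} (hη : η ∈ topDeg k (n + 1) (t - d)) (hJη : ∀ s ∈ J, s • η = 0)
    (hGη : ∀ g ∈ G, g • η = 0) : η = 0 := by
  induction i generalizing J d q t with
  | zero =>
    obtain ⟨α, hα, rfl⟩ := M.exists_eq t η hη hJη
    suffices h : α = 0 by rw [h, map_zero]
    refine Subtype.ext (funext fun σ => ?_)
    have h := Cech.mem_CDeg.1 (Cech.mem_ZDeg.1 hα) σ
    -- For σ = ∅ the denominator has degree zero, and no numerator has negative degree t.
    have hempty : Cech.locDeg (quotX J) (quotDeg J) σ.1 t = ⊥ := by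
      rw [Cech.locDeg, AddSubgroup.closure_eq_bot_iff]
      rintro a ⟨N, e, g, _, he, _⟩
      rw [σ.2] at he
      simp at he ht
      omega
    rw [hempty] at h
    exact h
  | succ i ih =>
    obtain ⟨g, hgG, hgD, hreg⟩ := exists_regular_form (M.Z_le_B 0 (by omega)) hG hprime
    obtain ⟨M'⟩ := M.quotient hJ hgD hreg
    have hgη : g • η = 0 := by
      have : Ideal.span G ≤ LinearMap.ker (LinearMap.toSpanSingleton _ _ η) :=
        Ideal.span_le.2 hGη
      exact this hgG
    -- Passing from (i + 1, t, d) to (i, t + D, d + D) preserves both t - d, the degree of η, and t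
    -- + iD, the quantity assumed negative.
    refine ih (hJ.sup_span_singleton hgD) M' (t := t + D) ?_ (by rwa [add_sub_add_right_eq_sub]) ?_
    · push_cast at ht
      linarith
    · intro s hs
      obtain ⟨u, hu, v, hv, rfl⟩ := Submodule.mem_sup.1 hs
      obtain ⟨w, rfl⟩ := Ideal.mem_span_singleton'.1 hv
      rw [add_smul, hJη u hu, mul_smul, hgη, smul_zero, add_zero]

end Vanishing

/-! ## Extension of the base field -/

section BaseChange

variable {k K : Type*} [Field k] [Field K] {m : ℕ} (φ : k →+* K)

/-- The extension of coefficients of Laurent polynomials. -/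
noncomputable def mapL (m : ℕ) : MvLaurent k m →+* MvLaurent K m :=
  AddMonoidAlgebra.mapRingHom (Fin m → ℤ) φ

theorem coeff_mapL (l : MvLaurent k m) (a : Fin m → ℤ) :
    (mapL φ m l).coeff a = φ (l.coeff a) := by
  simp [mapL]

theorem mapL_smul (s : MvPolynomial (Fin m) k) (l : MvLaurent k m) :
    mapL φ m (s • l) = MvPolynomial.map φ s • mapL φ m l := by
  rw [poly_smul_def, poly_smul_def, map_mul]
  congr 1
  induction s using MvPolynomial.induction_on' with
  | monomial u r => simp [mapL]
  | add s t hs ht => rw [map_add, map_add, map_add, map_add, hs, ht]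

theorem mapL_mem_nonneg_iff (l : MvLaurent k m) : mapL φ m l ∈ nonneg K m ↔ l ∈ nonneg k m := by
  simp only [mem_nonneg, coeff_mapL, map_eq_zero]

theorem mapL_mem_deg {t : ℤ} {l : MvLaurent k m} (hl : l ∈ deg k m t) :
    mapL φ m l ∈ deg K m t := fun a ha => by rw [coeff_mapL, hl a ha, map_zero]

end BaseChange

/-! ### Vanishing over an arbitrary field -/

section RegularSequence

variable {k : Type*} [Field k] {n : ℕ} (p : ℕ) [Fact p.Prime] [CharP k p]

include p in
/-- Vanishing over arbitrary fields. -/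
theorem eq_zero_of_isWeaklyRegular {l : List (MvPolynomial (Fin (n + 1)) k × ℕ)}
    (hl : ∀ g ∈ l, g.1.IsHomogeneous g.2)
    (hreg : RingTheory.Sequence.IsWeaklyRegular (MvPolynomial (Fin (n + 1)) k)
      (l.map Prod.fst).reverse) {i : ℕ} (hi : i + l.length = n + 1) {D : ℕ}
    {G : Set (MvPolynomial (Fin (n + 1)) k)} (hG : ∀ g ∈ G, ∃ e ≤ D, g.IsHomogeneous e)
    (hprime : ∀ P : Ideal (MvPolynomial (Fin (n + 1)) k), P.IsPrime → G ⊆ P → ∀ j, X j ∈ P)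
    {t : ℤ} (ht : t + i * D < 0) {η : Top k (n + 1)}
    (hη : η ∈ topDeg k (n + 1) (t - ((l.map Prod.snd).sum : ℕ)))
    (hJη : ∀ s ∈ Ideal.ofList (l.map Prod.fst), s • η = 0) (hGη : ∀ g ∈ G, g • η = 0) :
    η = 0 := by
  -- The choice of regular forms needs an infinite field. Extending coefficients is harmless: K[x]
  -- is flat over k[x], a class vanishes if its extension does, and primes of K[x] contract to
  -- primes of k[x].
  let K := AlgebraicClosure k
  have hKp : CharP K p := charP_of_injective_algebraMap (algebraMap k K).injective p
  let φ := algebraMap k K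
  let l' : List (MvPolynomial (Fin (n + 1)) K × ℕ) := l.map fun g => (MvPolynomial.map φ g.1, g.2)
  have hfst : l'.map Prod.fst = (l.map Prod.fst).map (MvPolynomial.map φ) := by
    simp [l', Function.comp_def]
  have hsnd : l'.map Prod.snd = l.map Prod.snd := by simp [l', Function.comp_def]
  have hl' : ∀ g ∈ l', g.1.IsHomogeneous g.2 := by
    intro g hg
    obtain ⟨g', hg', rfl⟩ := List.mem_map.1 hg
    exact (hl g' hg').map φ
  have hreg' : RevRegular (l'.map Prod.fst) := by
    let := algebraMvPolynomial (σ := Fin (n + 1)) (R := k) (S := K)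
    have : Module.Flat (MvPolynomial (Fin (n + 1)) k) (MvPolynomial (Fin (n + 1)) K) :=
      Module.Flat.isBaseChange k (MvPolynomial (Fin (n + 1)) k) K _
        (Algebra.IsPushout.out (R := k) (S := MvPolynomial (Fin (n + 1)) k) (R' := K)
          (S' := MvPolynomial (Fin (n + 1)) K))
    have h := revRegular_reverse (hreg.of_flat (S := MvPolynomial (Fin (n + 1)) K))
    rw [List.map_reverse, List.reverse_reverse] at h
    rw [hfst]
    exact h
  obtain ⟨M⟩ := nonempty_dualityMap p hl' hreg' (i := i) (by simpa [l'] using hi)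
  obtain ⟨x, hx, rfl⟩ := hη
  have hkill : ∀ s : MvPolynomial (Fin (n + 1)) k, s • (nonneg k (n + 1)).mkQ x = 0 →
      MvPolynomial.map φ s • (nonneg K (n + 1)).mkQ (mapL φ (n + 1) x) = 0 := by
    intro s hs
    rw [← map_smul, Submodule.mkQ_apply, Submodule.Quotient.mk_eq_zero] at hs ⊢
    rw [← mapL_smul]
    exact (mapL_mem_nonneg_iff φ _).2 hs
  suffices h : (nonneg K (n + 1)).mkQ (mapL φ (n + 1) x) = 0 by
    rw [Submodule.mkQ_apply, Submodule.Quotient.mk_eq_zero, mapL_mem_nonneg_iff] at h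
    exact (Submodule.Quotient.mk_eq_zero _).2 h
  refine M.eq_zero_of_infinite (D := D) (G := MvPolynomial.map φ '' G) ?_ ?_
    (generatedByForms_ofList hl') ht ?_ ?_ ?_
  · rintro _ ⟨g, hg, rfl⟩
    obtain ⟨e, he, hge⟩ := hG g hg
    exact ⟨e, he, hge.map φ⟩
  · intro P hP hGP j
    have := hprime (P.comap (MvPolynomial.map φ)) (hP.comap _)
      (fun g hg => hGP ⟨g, hg, rfl⟩) j
    rwa [Ideal.mem_comap, map_X] at this
  · rw [hsnd]
    exact ⟨_, mapL_mem_deg φ hx, rfl⟩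
  · intro s hs
    rw [hfst, ← Ideal.map_ofList] at hs
    induction hs using Submodule.span_induction with
    | zero => rw [zero_smul]
    | add x y _ _ hx hy => rw [add_smul, hx, hy, add_zero]
    | smul r x _ hx => rw [smul_eq_mul, mul_smul, hx, smul_zero]
    | mem s hs =>
      obtain ⟨s, hs, rfl⟩ := hs
      exact hkill s (hJη s hs)
  · rintro _ ⟨g, hg, rfl⟩
    exact hkill g (hGη g hg)

end RegularSequence

end MvLaurent

namespace Cech

variable {A : Type*} [CommRing A] {m : ℕ} (x : Fin m → A) (p : ℕ) [Fact p.Prime]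
  (hp : (p : A) = 0) (𝒜 : ℕ → AddSubgroup A)

theorem mkQ_eq_zero_iff (i : ℕ) (α : Z x i) :
    ((B x i).submoduleOf (Z x i)).mkQ α = 0 ↔ α.1 ∈ B x i :=
  Submodule.Quotient.mk_eq_zero _

theorem injective_frobHLT_iff [SetLike.GradedMonoid 𝒜] (i : ℕ) (N : ℤ) :
    Function.Injective (frobHLT x p hp 𝒜 i N) ↔
      ∀ z ∈ HLT x 𝒜 i N, frobH x p hp i z = 0 → z = 0 := by
  rw [injective_iff_map_eq_zero]
  constructor
  · intro h z hz h0
    exact congrArg Subtype.val (h ⟨z, hz⟩ (Subtype.ext h0))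
  · intro h z h0
    exact Subtype.ext (h z.1 z.2 (congrArg Subtype.val h0))

end Cech

namespace MvLaurent

/-! ### Translation of injectivity into annihilators -/

section Injectivity

variable {k : Type*} [Field k] {n : ℕ} {p : ℕ} [Fact p.Prime] [CharP k p]
  {J : Ideal (MvPolynomial (Fin (n + 1)) k)} {i : ℕ} {d : ℤ} {q : MvPolynomial (Fin (n + 1)) k}

theorem DualityMap.smul_eq_zero (M : DualityMap p J i d q) (α : Cech.Z (quotX J) i)
    {s : MvPolynomial (Fin (n + 1)) k} (hs : s ∈ J) : s • M.Φ α = 0 := by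
  rw [← M.map_smul, Ideal.Quotient.eq_zero_iff_mem.2 hs]
  exact (congrArg M.Φ (zero_smul (MvPolynomial (Fin (n + 1)) k ⧸ J) α)).trans (map_zero M.Φ)

theorem DualityMap.exists_of_mem_HLT (M : DualityMap p J i d q) {N : ℤ}
    {z : Cech.H (quotX J) i} (hz : z ∈ Cech.HLT (quotX J) (quotDeg J) i N) :
    ∃ α, Submodule.mkQ _ α = z ∧
      M.Φ α ∈ ⨆ t : {t : ℤ // t < N - d}, topDeg k (n + 1) t.1 := by
  refine AddSubgroup.iSup_induction (C := fun z => ∃ α, Submodule.mkQ _ α = z ∧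
      M.Φ α ∈ ⨆ t : {t : ℤ // t < N - d}, topDeg k (n + 1) t.1) _ hz ?_ ?_ ?_
  · rintro t _ ⟨α, hα, rfl⟩
    exact ⟨α, rfl, AddSubgroup.mem_iSup_of_mem
      (⟨t.1 - d, by have := t.2; omega⟩ : {t : ℤ // t < N - d}) (M.map_deg _ α hα)⟩
  · exact ⟨0, map_zero _, by rw [map_zero]; exact zero_mem _⟩
  · rintro _ _ ⟨α, rfl, hα⟩ ⟨β, rfl, hβ⟩
    exact ⟨α + β, map_add _ _ _, by rw [map_add]; exact add_mem hα hβ⟩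

theorem DualityMap.frobH_mkQ_eq_zero_iff (M : DualityMap p J i d q) (α : Cech.Z (quotX J) i) :
    Cech.frobH (quotX J) p (quot_natCast_eq_zero p J) i (Submodule.mkQ _ α) = 0 ↔
      q ^ (p - 1) • frobTop k (n + 1) p (M.Φ α) = 0 := by
  rw [← M.map_frob, M.eq_zero_iff]
  exact Cech.mkQ_eq_zero_iff _ _ _

theorem smul_eq_zero_of_mem_span {A M : Type*} [CommRing A] [AddCommGroup M] [Module A M]
    {G : Set A} {η : M} (h : ∀ g ∈ G, g • η = 0) {s : A} (hs : s ∈ Ideal.span G) : s • η = 0 := by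
  have hle : Ideal.span G ≤ Ideal.torsionOf A M η :=
    Ideal.span_le.2 fun g hg => (Ideal.mem_torsionOf_iff η g).2 (h g hg)
  exact (Ideal.mem_torsionOf_iff η s).1 (hle hs)

/-- The Frobenius action in low degrees is injective if and only if no nonzero homogeneous class
of low degree is killed by `G`, where `G` describes the kernel of the twisted Frobenius. -/
theorem DualityMap.injective_frobeniusAction_iff (M : DualityMap p J i d q) {N : ℤ}
    {G : Set (MvPolynomial (Fin (n + 1)) k)} (hG : ∀ g ∈ G, ∃ e, g.IsHomogeneous e)
    (hJG : J ≤ Ideal.span G)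
    (hGq : ∀ η : Top k (n + 1), (∀ s ∈ J, s • η = 0) →
      (q ^ (p - 1) • frobTop k (n + 1) p η = 0 ↔ ∀ g ∈ G, g • η = 0)) :
    Function.Injective (frobeniusAction p J i N) ↔
      ∀ t < N, ∀ η ∈ topDeg k (n + 1) (t - d), (∀ g ∈ G, g • η = 0) → η = 0 := by
  rw [frobeniusAction, Cech.injective_frobHLT_iff]
  constructor
  · intro h t ht η hη hGη
    have hJη : ∀ s ∈ J, s • η = 0 := fun s hs => smul_eq_zero_of_mem_span hGη (hJG hs)
    obtain ⟨α, hα, rfl⟩ := M.exists_eq t η hη hJη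
    rw [M.eq_zero_iff, ← Cech.mkQ_eq_zero_iff]
    refine h _ (AddSubgroup.mem_iSup_of_mem (⟨t, ht⟩ : {t : ℤ // t < N}) ⟨α, hα, rfl⟩) ?_
    exact (M.frobH_mkQ_eq_zero_iff α).2 ((hGq _ hJη).2 hGη)
  · intro h z hz h0
    obtain ⟨α, rfl, hα⟩ := M.exists_of_mem_HLT hz
    have hGα := (hGq _ fun s hs => M.smul_eq_zero α hs).1 ((M.frobH_mkQ_eq_zero_iff α).1 h0)
    rw [Cech.mkQ_eq_zero_iff, ← M.eq_zero_iff]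
    -- The kernel is cut out by forms, so each homogeneous component of the class lies in it too and
    -- may be treated separately.
    refine eq_zero_of_mem_iSup_topDeg hG (fun t ht η hη hGη => ?_) hα hGα
    exact h (t + d) (by omega) η (by rwa [add_sub_cancel_right]) hGη

end Injectivity

/-! ### Homogeneous ideals with radical 𝔪 -/

section Radical

variable {k : Type*} [Field k] {m : ℕ}

theorem span_range_X_eq_ker :
    Ideal.span (Set.range (X : Fin m → MvPolynomial (Fin m) k)) =
      RingHom.ker (constantCoeff (σ := Fin m) (R := k)) := by
  ext s
  rw [← Set.image_univ, mem_ideal_span_X_image, RingHom.mem_ker, constantCoeff_eq]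
  constructor
  · intro h
    by_contra h0
    obtain ⟨j, -, hj⟩ := h 0 (mem_support_iff.2 h0)
    exact hj rfl
  · intro h u hu
    by_contra! hu0
    obtain rfl : u = 0 := Finsupp.ext fun j => hu0 j (Set.mem_univ j)
    exact mem_support_iff.1 hu h

theorem _root_.Ideal.GeneratedByForms.le_span_range_X {I : Ideal (MvPolynomial (Fin m) k)}
    (hI : I.GeneratedByForms) (hne : I ≠ ⊤) :
    I ≤ Ideal.span (Set.range (X : Fin m → MvPolynomial (Fin m) k)) := by
  obtain ⟨G, hG, rfl⟩ := hI
  rw [span_range_X_eq_ker]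
  refine Ideal.span_le.2 fun g hg => ?_
  obtain ⟨e, he⟩ := hG g hg
  rw [SetLike.mem_coe, RingHom.mem_ker, constantCoeff_eq]
  by_contra h0
  -- A form with nonzero constant term is a nonzero constant, which a proper ideal cannot contain.
  obtain rfl : e = 0 := by simpa using (he h0).symm
  have hC : g = C (g.coeff 0) :=
    totalDegree_eq_zero_iff_eq_C.1 (Nat.le_zero.1 he.totalDegree_le)
  refine hne (Ideal.eq_top_of_isUnit_mem _ (Ideal.subset_span hg) ?_)
  rw [hC]
  exact (isUnit_iff_ne_zero.2 h0).map C

theorem _root_.Ideal.GeneratedByForms.radical_eq_span_range_X {I : Ideal (MvPolynomial (Fin m) k)}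
    (hI : I.GeneratedByForms) (hne : I ≠ ⊤) (h : ∀ j, ∃ e, (X j : MvPolynomial (Fin m) k) ^ e ∈ I) :
    I.radical = Ideal.span (Set.range (X : Fin m → MvPolynomial (Fin m) k)) := by
  refine le_antisymm ?_ (Ideal.span_le.2 ?_)
  · have hprime : (RingHom.ker (constantCoeff (σ := Fin m) (R := k))).IsPrime :=
      RingHom.ker_isPrime _
    refine (Ideal.radical_mono (hI.le_span_range_X hne)).trans ?_
    rw [span_range_X_eq_ker, hprime.radical]
  · rintro _ ⟨j, rfl⟩
    exact h j

end Radical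

/-! ### The criterion for τ -/

section Main

variable {k : Type*} [Field k] (p : ℕ) [Fact p.Prime] [CharP k p] {n c r : ℕ}

/-- The duality map of a regular sequence of forms, and the vanishing in low degrees. -/
theorem nonempty_dualityMap_ofFn {f : Fin c → MvPolynomial (Fin (n + 1)) k} {deg : Fin c → ℕ}
    (hf : ∀ j, (f j).IsHomogeneous (deg j))
    (hreg : RingTheory.Sequence.IsRegular (MvPolynomial (Fin (n + 1)) k) (List.ofFn f)) :
    c ≤ n + 1 ∧ Nonempty (DualityMap p (Ideal.span (Set.range f)) (n + 1 - c)
      ((∑ j, deg j : ℕ) : ℤ) (∏ j, f j)) ∧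
    ∀ (G : Set (MvPolynomial (Fin (n + 1)) k)), (∀ g ∈ G, ∃ e ≤ ∑ j, deg j, g.IsHomogeneous e) →
      Set.range f ⊆ G →
      (∀ P : Ideal (MvPolynomial (Fin (n + 1)) k), P.IsPrime → G ⊆ P → ∀ j, X j ∈ P) →
      ∀ t : ℤ, t + (n + 1 - c : ℕ) * (∑ j, deg j : ℕ) < 0 →
      ∀ η ∈ topDeg k (n + 1) (t - (∑ j, deg j : ℕ)), (∀ g ∈ G, g • η = 0) → η = 0 := by
  let l : List (MvPolynomial (Fin (n + 1)) k × ℕ) := (List.ofFn fun j => (f j, deg j)).reverse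
  have hfst : l.map Prod.fst = (List.ofFn f).reverse := by
    simp [l, List.map_ofFn, Function.comp_def]
  have hideal : Ideal.ofList (l.map Prod.fst) = Ideal.span (Set.range f) := by
    rw [hfst, ofList_reverse, Ideal.ofList]
    simp [Set.range, List.mem_ofFn]
  have hdeg : (l.map Prod.snd).sum = ∑ j, deg j := by
    simp [l, List.map_ofFn, Function.comp_def, List.sum_ofFn]
  have hprod : (l.map Prod.fst).prod = ∏ j, f j := by
    rw [hfst, List.prod_reverse, List.prod_ofFn]
  have hlen : l.length = c := by simp [l]
  have hl : ∀ g ∈ l, g.1.IsHomogeneous g.2 := by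
    intro g hg
    obtain ⟨j, rfl⟩ := List.mem_ofFn.1 (List.mem_reverse.1 hg)
    exact hf j
  have hrev : RevRegular (l.map Prod.fst) := hfst ▸ revRegular_reverse hreg.toIsWeaklyRegular
  have hc : c ≤ n + 1 := hlen ▸ length_le_of_revRegular p hl hrev fun h => hreg.top_ne_smul (by
    rw [hfst, ofList_reverse] at h
    rw [h, smul_eq_mul, Ideal.mul_top])
  have hi : n + 1 - c + l.length = n + 1 := by omega
  refine ⟨hc, ?_, fun G hG hfG hprime t ht η hη hGη => ?_⟩
  · have h := nonempty_dualityMap p hl hrev hi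
    rwa [hideal, hdeg, hprod] at h
  · refine eq_zero_of_isWeaklyRegular p hl
      (by rw [hfst, List.reverse_reverse]; exact hreg.toIsWeaklyRegular) hi hG hprime ht
      (by rwa [hdeg]) ?_ hGη
    rw [hideal]
    exact fun s hs => smul_eq_zero_of_mem_span hGη (Ideal.span_mono hfG hs)

set_option maxHeartbeats 1000000 in
/-- The radical criterion for `τ`, given by its generators. -/
theorem radical_span_tauGens_iff {e : Fin r → k} {θ : Fin r → k →+ k}
    (hθ : ∀ b s y, θ b (s ^ p * y) = s * θ b y) (hsum : ∀ y, ∑ b, θ b y ^ p * e b = y)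
    {f : Fin c → MvPolynomial (Fin (n + 1)) k} {deg : Fin c → ℕ}
    (hf : ∀ j, (f j).IsHomogeneous (deg j))
    (hreg : RingTheory.Sequence.IsRegular (MvPolynomial (Fin (n + 1)) k) (List.ofFn f))
    (hne : Ideal.span (tauGens p θ f) ≠ ⊤) :
    (Ideal.span (tauGens p θ f)).radical =
        Ideal.span (Set.range (X : Fin (n + 1) → MvPolynomial (Fin (n + 1)) k)) ↔
      Function.Injective (frobeniusAction p (Ideal.span (Set.range f)) (n + 1 - c)
        (-(((n : ℤ) + 1 - c) * ∑ j, (deg j : ℤ)))) := by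
  have h := nonempty_dualityMap_ofFn p hf hreg
  obtain ⟨hc, ⟨M⟩, hvan⟩ := h
  have hforms : ∀ g ∈ tauGens p θ f, ∃ e ≤ ∑ j, deg j, g.IsHomogeneous e :=
    fun g hg => isHomogeneous_of_mem_tauGens p hf hg
  have hforms' : ∀ g ∈ tauGens p θ f, ∃ e, g.IsHomogeneous e := fun g hg =>
    (hforms g hg).imp fun _ h => h.2
  have hgen : (Ideal.span (tauGens p θ f)).GeneratedByForms := ⟨_, hforms', rfl⟩
  -- The bound c ≤ n + 1 makes the truncated subtraction agree with the integer one.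
  have hN : (n : ℤ) + 1 - c = (n + 1 - c : ℕ) := by omega
  rw [hN, ← Nat.cast_sum]
  have key := M.injective_frobeniusAction_iff (N := -(((n + 1 - c : ℕ) : ℤ) * (∑ j, deg j : ℕ)))
    hforms' (Ideal.span_mono Set.subset_union_left)
    fun η hη => smul_frobTop_eq_zero_iff p hθ hsum f hη
  refine Iff.trans ?_ key.symm
  constructor
  · intro hrad t ht η hη hGη
    refine hvan _ hforms Set.subset_union_left (fun P hP hGP j => ?_) t (by linarith) η hη hGη
    -- A prime containing the generators of τ contains its radical, hence all variables.
    refine hP.radical_le_iff.2 (Ideal.span_le.2 hGP) ?_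
    rw [hrad]
    exact Ideal.subset_span ⟨j, rfl⟩
  · intro h
    refine hgen.radical_eq_span_range_X hne fun j => ?_
    by_contra! hj
    -- The class dual to X_j^s has degree -s - (n + 1); this s brings that degree, shifted by d,
    -- below the bound -(n+1-c)d.
    obtain ⟨s, hs⟩ : ∃ s : ℕ, ((n + 1 - c : ℕ) : ℤ) * (∑ j, deg j : ℕ) + (∑ j, deg j : ℕ) < s :=
      ⟨(n + 1 - c) * ∑ j, deg j + ∑ j, deg j + 1, by push_cast; omega⟩
    obtain ⟨η, hη, hη0, hkill⟩ := exists_ne_zero_of_notMem hgen (isHomogeneous_X_pow j s) (hj s)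
    refine hη0 (h (-s - (n + 1 : ℕ) + (∑ j, deg j : ℕ)) ?_ η ?_
      fun g hg => hkill g (Ideal.subset_span hg))
    · push_cast at hs ⊢; linarith
    · rwa [add_sub_cancel_right]

end Main

end MvLaurent

set_option maxHeartbeats 1000000 in
theorem corollary3p4 {k : Type*} [Field k] (p : ℕ) [Fact p.Prime] [CharP k p]
    -- `[k : k^p] < ∞`
    (hk : (frobenius k p).Finite)
    (n c : ℕ) (f : Fin c → MvPolynomial (Fin (n + 1)) k) (deg : Fin c → ℕ)
    (hf : ∀ j, (f j).IsHomogeneous (deg j))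
    (hreg : RingTheory.Sequence.IsRegular (MvPolynomial (Fin (n + 1)) k) (List.ofFn f)) :
    -- the smallest ideal exists, and it is `tau p f`
    IsLeast (tauSet p f) (tau p f) ∧
    (tau p f ≠ ⊤ →
      ((tau p f).radical = Ideal.span (Set.range (X : Fin (n + 1) → MvPolynomial (Fin (n + 1)) k)) ↔
        Function.Injective
          (frobeniusAction p (Ideal.span (Set.range f)) (n + 1 - c)
            (-(((n : ℤ) + 1 - c) * ∑ j, (deg j : ℤ)))))) := by
  have h := hk.exists_coordinates
  -- A basis of k over k^p with its coordinate functions, read as p^{-1}-linear maps k → k.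
  obtain ⟨r, e, θ, hθ, hsum⟩ := h
  have hleast := MvLaurent.isLeast_tauSet p hθ hsum f
  have hτ : tau p f = Ideal.span (MvLaurent.tauGens p θ f) := hleast.isGLB.sInf_eq
  rw [hτ]
  exact ⟨hleast, fun hne => MvLaurent.radical_span_tauGens_iff p hθ hsum hf hreg hne⟩
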